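/- **Setting.** Let $R$ be a (not necessarily commutative) domain and let $\mathsf R=R[Y_1;\alpha_1,\delta_1]\cdots[Y_n;\alpha_n,\delta_n]$ be a multivariate Ore extension: the $\alpha_i$ are injective ring endomorphisms of $R$, each $\delta_i$ is an $\alpha_i$-derivation of $R$ (additive, $\delta_i(rs)=\alpha_i(r)\delta_i(s)+\delta_i(r)s$), the $\alpha_i$ commute with each other, the $\delta_i$ commute with each other, $\alpha_i\delta_j=\delta_j\alpha_i$ for $i\ne j$, and $\mathsf R$ is the free left $R$-module on the set $\mathcal T$ of terms $Y_1^{a_1}\cdots Y_n^{a_n}$, with the associative multiplication $\star$ for which $Y_i\star r=\alpha_i(r)Y_i+\delta_i(r)$ ($r\in R$) and the $Y_i$ commute. Let $\mathsf S=R[Y_1;\alpha_1]\cdots[Y_n;\alpha_n]$ be the associated graded Ore extension (same left $R$-module, $\delta_i=0$), with multiplication $\ast$, and let $\circ$ be the commutative multiplication of $\mathcal T$, acting also on $\mathcal T^{(m)}=\{t\mathbf e_i: t\in\mathcal T,\ 1\le i\le m\}$. Fix a term ordering $\prec$ on $\mathcal T$ (a total well-ordering compatible with $\circ$) and a term ordering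 $<$ on $\mathcal T^{(m)}$ compatible with it: a total well-ordering with $\omega_1\prec\omega_2\Rightarrow\omega_1\circ t<\omega_2\circ t$ and $t_1<t_2\Rightarrow\omega\circ t_1<\omega\circ t_2$ for all $\omega,\omega_1,\omega_2\in\mathcal T$ and $t,t_1,t_2\in\mathcal T^{(m)}$. For $0\neq f\in\mathsf R^m$ let $\mathbf T(f)$ and $\mathbf M(f)$ be its maximal term and maximal monomial (maximal term together with its coefficient); for a set $A$ put $\mathbf M\{A\}=\{\mathbf M(f):0\ne f\in A\}$. Let $F=\{g_1,\dots,g_u\}\subset\mathsf R^m\setminus\{0\}$ be finite and let $\mathsf M=\mathbb I_2(F)$ be the bilateral $\mathsf R$-submodule of $\mathsf R^m$ it generates. Let $\hat R\subset R$ be the commutative subring of the elements of $R$ that are central in $\mathsf R$. The $\hat R$-modules $(\mathsf R\otimes_{\hat R}\mathsf R^{op})^u$ and $(\mathsf S\otimes_{\hat R}\mathsf S^{op})^u$ coincide and are the direct sum, over $\lambda,\rho\in\mathcal T$ and $1\le\ell\le u$, of the components $R\lambda\, e_\ell\, R\rho\cong R\otimes_{\hat R}R$ spanned by the elements $a\lambda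 e_\ell b\rho$ ($a,b\in R$); such a component has degree $\lambda\circ\mathbf T(g_\ell)\circ\rho\in\mathcal T^{(m)}$. For an element $\sigma$, the valuation $v(\sigma)$ is the largest degree of its nonzero components ($v(0)=-\infty$), the leading form $\mathcal L_2(\sigma)$ is the sum of its components of degree $v(\sigma)$, and $\sigma$ is $\mathcal T^{(m)}$-homogeneous if all its nonzero components have the same degree. Let $$\mathfrak S_2:(\mathsf R\otimes_{\hat R}\mathsf R^{op})^u\to\mathsf R^m,\quad \sum_i a_i\lambda_ie_{\ell_i}b_i\rho_i\mapsto\sum_i a_i\lambda_i\star g_{\ell_i}\star b_i\rho_i,$$ $$\mathfrak s_2:(\mathsf S\otimes_{\hat R}\mathsf S^{op})^u\to\mathsf S^m,\quad \sum_i a_i\lambda_ie_{\ell_i}b_i\rho_i\mapsto\sum_i a_i\lambda_i\ast \mathbf M(g_{\ell_i})\ast b_i\rho_i.$$ *Definitions.* - $F$ is a *bilateral Gröbner basis* of $\mathsf M$ if $\mathbf M\{\mathsf M\}=\mathbf M\{\mathbb I\}=\mathbb I\cap\{c\,t: c\in R\setminus\{0\},t\in\mathcal T^{(m)}\}$, where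 $\mathbb I\subset\mathsf S^m$ is the bilateral $\mathsf S$-submodule generated by $\mathbf M\{F\}$. - $f\ne0$ has a *bilateral Gröbner representation* in terms of $F$ if $f=\sum_{i=1}^\mu a_i\lambda_i\star g_{\ell_i}\star b_i\rho_i$ with $\mu\in\mathbb N$, $a_i,b_i\in R\setminus\{0\}$, $\lambda_i,\rho_i\in\mathcal T$ and $\mathbf T(\lambda_i\star g_{\ell_i}\star\rho_i)\le\mathbf T(f)$ for each $i$. - For homogeneous $\sigma$, $\mathfrak S_2(\sigma)$ has a *bilateral quasi-Gröbner representation* in terms of $F$ if $\mathfrak S_2(\sigma)=\sum_{i=1}^\mu a_i\lambda_i\star g_{\ell_i}\star b_i\rho_i$ with $\mu\in\mathbb N$, $a_i,b_i\in R\setminus\{0\}$, $\lambda_i,\rho_i\in\mathcal T$ and $\lambda_i\circ\mathbf T(g_{\ell_i})\circ\rho_i<v(\sigma)$ for each $i$. - A homogeneous $\sigma\in\ker\mathfrak s_2$ *has a lifting* if there is $U\in\ker\mathfrak S_2$ with $\mathcal L_2(U)=\sigma$. - A *bilateral Gebauer–Möller set* for $F$ is a set of homogeneous elements generating $\ker\mathfrak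 s_2$ as a bilateral $\mathsf S$-module. **Theorem (Möller–Pritchard).** Let $\mathfrak{GM}(F)$ be any bilateral Gebauer–Möller set for $F$. The following are equivalent: 1. $F$ is a bilateral Gröbner basis of $\mathsf M$; 2. for each $f\in\mathsf R^m\setminus\{0\}$: $f\in\mathsf M$ if and only if $f$ has a bilateral Gröbner representation in terms of $F$; 3. for each $\sigma\in\mathfrak{GM}(F)$, the bilateral S-polynomial $\mathfrak S_2(\sigma)$ has a bilateral quasi-Gröbner representation in terms of $F$; 4. each $\sigma\in\mathfrak{GM}(F)$ has a lifting; 5. each $\mathcal T^{(m)}$-homogeneous $\sigma\in\ker\mathfrak s_2$ has a lifting. -/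

import Mathlib

open scoped TensorProduct

/-- Exponent vectors `(a₁,…,aₙ)`; `t` stands for the term `Y₁^{a₁}⋯Yₙ^{aₙ}` of `𝒯`, and the
commutative multiplication `∘` of `𝒯` is the addition of exponent vectors. -/
abbrev Expo (n : ℕ) : Type := Fin n →₀ ℕ

/-- The left `R`-module `R[Y₁,…,Yₙ]` with basis `𝒯`: the common underlying left module of a
multivariate Ore extension and of its associated graded Ore extension. -/
abbrev OreCarrier (n : ℕ) (R : Type*) [Ring R] : Type _ := Expo n →₀ R

/-- The data defining a multivariate Ore extension `R[Y₁;α₁,δ₁]⋯[Yₙ;αₙ,δₙ]` of `R`: injective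
endomorphisms `αᵢ`, and `αᵢ`-derivations `δᵢ`, subject to the commutation rules. -/
structure OreData (n : ℕ) (R : Type*) [Ring R] where
  α : Fin n → R →+* R
  δ : Fin n → R →+ R
  α_injective : ∀ i, Function.Injective (α i)
  δ_mul : ∀ i r s, δ i (r * s) = α i r * δ i s + δ i r * s
  α_comm : ∀ i j r, α i (α j r) = α j (α i r)
  δ_comm : ∀ i j r, δ i (δ j r) = δ j (δ i r)
  α_δ_comm : ∀ i j r, i ≠ j → α i (δ j r) = δ j (α i r)

namespace OreData

variable {n : ℕ} {R : Type*} [Ring R] (D : OreData n R)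

/-- The data of the associated graded Ore extension: same `αᵢ`, zero derivations. -/
def graded : OreData n R where
  α := D.α
  δ := fun _ => 0
  α_injective := D.α_injective
  δ_mul := by simp
  α_comm := D.α_comm
  δ_comm := by simp
  α_δ_comm := by simp

/-- Left multiplication by `Yᵢ`: `Yᵢ ⋆ (r t) = αᵢ(r) Yᵢ t + δᵢ(r) t`. -/
noncomputable def stepY (i : Fin n) : AddMonoid.End (OreCarrier n R) :=
  Finsupp.liftAddHom fun t =>
    (Finsupp.singleAddHom (t + Finsupp.single i 1)).comp (D.α i).toAddMonoidHom +
      (Finsupp.singleAddHom t).comp (D.δ i)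

theorem stepY_single (i : Fin n) (t : Expo n) (r : R) :
    D.stepY i (Finsupp.single t r) =
      Finsupp.single (t + Finsupp.single i 1) (D.α i r) + Finsupp.single t (D.δ i r) := by
  rw [stepY]
  exact Finsupp.liftAddHom_apply_single _ _ _

theorem stepY_comm (i j : Fin n) : Commute (D.stepY i) (D.stepY j) := by
  rcases eq_or_ne i j with rfl | hij
  · exact Commute.refl _
  · refine Finsupp.addHom_ext fun t r => ?_
    change D.stepY i (D.stepY j _) = D.stepY j (D.stepY i _)
    simp only [stepY_single, map_add]
    rw [D.α_comm i j, D.δ_comm i j, D.α_δ_comm i j r hij, ← D.α_δ_comm j i r hij.symm,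
      add_right_comm t]
    abel

/-- Left multiplication by the term `t`, the composite `Y₁^{t₁} ∘ ⋯ ∘ Yₙ^{tₙ}`. -/
noncomputable def powY (t : Expo n) : AddMonoid.End (OreCarrier n R) :=
  ((List.finRange n).map fun i => D.stepY i ^ t i).prod

/-- Left multiplication by the coefficient `r`: `r (s t) = (r s) t`. -/
noncomputable def coef : R →+* AddMonoid.End (OreCarrier n R) :=
  Module.toAddMonoidEnd R (OreCarrier n R)

/-- Left multiplication by `f = ∑ₜ c(f,t) t`, as an additive function of `f`. -/
noncomputable def leftMul : OreCarrier n R →+ AddMonoid.End (OreCarrier n R) :=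
  Finsupp.liftAddHom fun t => (AddMonoidHom.mulRight (D.powY t)).comp coef.toAddMonoidHom

/-- The multiplication of the multivariate Ore extension, on the left `R`-module with basis `𝒯`:
`⋆` for the given data, and `∗` for `D.graded`. -/
noncomputable def mul (f g : OreCarrier n R) : OreCarrier n R := D.leftMul f g

theorem end_mul_apply (φ ψ : AddMonoid.End (OreCarrier n R)) (f : OreCarrier n R) :
    (φ * ψ) f = φ (ψ f) := rfl

theorem coef_apply (r : R) (f : OreCarrier n R) : coef r f = r • f := rfl

theorem leftMul_single (t : Expo n) (r : R) :
    D.leftMul (Finsupp.single t r) = coef r * D.powY t := by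
  simp [leftMul]

theorem powY_zero : D.powY 0 = 1 := by
  simp [powY]

theorem powY_add (s t : Expo n) : D.powY (s + t) = D.powY s * D.powY t := by
  unfold powY
  induction List.finRange n with
  | nil => simp
  | cons i l ih =>
    have hc : Commute (D.stepY i ^ t i) (l.map fun j => D.stepY j ^ s j).prod := by
      refine Commute.list_prod_right _ _ fun x hx => ?_
      obtain ⟨j, -, rfl⟩ := List.mem_map.1 hx
      exact (D.stepY_comm i j).pow_pow _ _
    rw [List.map_cons, List.prod_cons, ih, Finsupp.add_apply, pow_add, mul_assoc,
      ← mul_assoc (D.stepY i ^ t i), hc.eq, List.map_cons, List.prod_cons, List.map_cons,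
      List.prod_cons, mul_assoc, mul_assoc]

theorem powY_single (i : Fin n) : D.powY (Finsupp.single i 1) = D.stepY i := by
  classical
  have h : ∀ l : List (Fin n), l.Nodup →
      (l.map fun j => D.stepY j ^ (Finsupp.single i 1 : Expo n) j).prod =
        if i ∈ l then D.stepY i else 1 := by
    intro l hl
    induction l with
    | nil => simp
    | cons j l ih =>
      rw [List.nodup_cons] at hl
      rw [List.map_cons, List.prod_cons, ih hl.2]
      rcases eq_or_ne i j with rfl | hij
      · simp [hl.1]
      · simp [hij]
  rw [powY, h _ (List.nodup_finRange n), if_pos (List.mem_finRange i)]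

theorem δ_one (i : Fin n) : D.δ i 1 = 0 := by
  have := D.δ_mul i 1 1
  simpa using this

theorem stepY_coef (i : Fin n) (r : R) :
    D.stepY i * coef r = coef (D.α i r) * D.stepY i + coef (D.δ i r) := by
  refine Finsupp.addHom_ext fun t s => ?_
  change D.stepY i (r • _) = D.α i r • D.stepY i _ + D.δ i r • _
  simp only [Finsupp.smul_single, smul_eq_mul, stepY_single, map_mul, δ_mul, smul_add,
    Finsupp.single_add, add_assoc]

theorem leftMul_stepY (i : Fin n) (g : OreCarrier n R) :
    D.leftMul (D.stepY i g) = D.stepY i * D.leftMul g := by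
  induction g using Finsupp.induction_linear with
  | zero => simp
  | add f g hf hg => simp only [map_add, hf, hg, mul_add]
  | single t s =>
    rw [stepY_single, map_add, leftMul_single, leftMul_single, leftMul_single, ← mul_assoc,
      stepY_coef, add_mul, mul_assoc, ← powY_single, ← powY_add, add_comm t]

theorem leftMul_powY (t : Expo n) (g : OreCarrier n R) :
    D.leftMul (D.powY t g) = D.powY t * D.leftMul g := by
  induction t using Finsupp.induction_linear generalizing g with
  | zero => simp [powY_zero]
  | add s t hs ht =>
    rw [powY_add, mul_assoc, ← ht, ← hs]; rfl
  | single i k =>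
    induction k generalizing g with
    | zero => simp [powY_zero]
    | succ k ih =>
      rw [Finsupp.single_add, powY_add, powY_single, mul_assoc, ← leftMul_stepY, ← ih]; rfl

theorem leftMul_smul (r : R) (g : OreCarrier n R) :
    D.leftMul (r • g) = coef r * D.leftMul g := by
  induction g using Finsupp.induction_linear with
  | zero => simp
  | add f g hf hg => simp only [smul_add, map_add, hf, hg, mul_add]
  | single t s => rw [Finsupp.smul_single, leftMul_single, leftMul_single, smul_eq_mul, map_mul,
      mul_assoc]

theorem leftMul_mul (f g : OreCarrier n R) :
    D.leftMul (D.mul f g) = D.leftMul f * D.leftMul g := by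
  induction f using Finsupp.induction_linear with
  | zero => simp [mul]
  | add f₁ f₂ h₁ h₂ =>
    have : D.mul (f₁ + f₂) g = D.mul f₁ g + D.mul f₂ g := by
      unfold mul
      rw [map_add]; rfl
    rw [this, map_add, h₁, h₂, map_add, add_mul]
  | single t r =>
    have : D.mul (Finsupp.single t r) g = r • D.powY t g := by
      rw [mul, leftMul_single]; rfl
    rw [this, leftMul_smul, leftMul_powY, leftMul_single, mul_assoc]

theorem powY_one (t : Expo n) :
    D.powY t (Finsupp.single 0 1) = Finsupp.single t 1 := by
  suffices h : ∀ s, D.powY t (Finsupp.single s 1) = Finsupp.single (t + s) 1 by simpa using h 0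
  induction t using Finsupp.induction_linear with
  | zero => simp [powY_zero]
  | add s t hs ht =>
    intro u
    rw [powY_add, end_mul_apply, ht, hs, add_assoc]
  | single i k =>
    induction k with
    | zero => simp [powY_zero]
    | succ k ih =>
      intro u
      rw [Finsupp.single_add, powY_add, powY_single, end_mul_apply, stepY_single,
        map_one, δ_one, Finsupp.single_zero, add_zero, ih, add_assoc, add_comm u]

theorem mul_single_one (f : OreCarrier n R) : D.mul f (Finsupp.single 0 1) = f := by
  induction f using Finsupp.induction_linear with
  | zero => simp [mul]
  | add f₁ f₂ h₁ h₂ =>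
    unfold mul at *
    rw [map_add]
    exact congrArg₂ (· + ·) h₁ h₂
  | single t r =>
    rw [mul, leftMul_single, end_mul_apply, powY_one, coef_apply, Finsupp.smul_single]
    simp

end OreData

/-- The multivariate Ore extension `𝖱 = R[Y₁;α₁,δ₁]⋯[Yₙ;αₙ,δₙ]`. -/
def OreExt {n : ℕ} {R : Type*} [Ring R] (_D : OreData n R) : Type _ := OreCarrier n R

namespace OreData

variable {n : ℕ} {R : Type*} [Ring R] (D : OreData n R)

noncomputable instance : AddCommGroup (OreExt D) :=
  inferInstanceAs (AddCommGroup (OreCarrier n R))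

/-- With the multiplication `D.mul`, the left `R`-module with basis `𝒯` is a ring. -/
noncomputable instance : Ring (OreExt D) :=
  { (inferInstance : AddCommGroup (OreExt D)) with
    mul := D.mul
    one := (Finsupp.single 0 1 : OreCarrier n R)
    left_distrib := fun f g h => map_add (D.leftMul f) g h
    right_distrib := fun f g h => congrArg (fun φ => φ h) (map_add D.leftMul f g)
    zero_mul := fun f => congrArg (fun φ => φ f) (map_zero D.leftMul)
    mul_zero := fun f => map_zero (D.leftMul f)
    mul_assoc := fun f g h => congrArg (fun φ => φ h) (D.leftMul_mul f g)
    one_mul := fun f => by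
      have h : D.leftMul (Finsupp.single 0 1) = 1 := by
        rw [leftMul_single, powY_zero, map_one, mul_one]
      exact congrArg (fun φ => φ f) h
    mul_one := fun f => D.mul_single_one f }

theorem mul_add_right (f g h : OreCarrier n R) : D.mul f (g + h) = D.mul f g + D.mul f h :=
  map_add (D.leftMul f) g h

theorem mul_add_left (f g h : OreCarrier n R) : D.mul (f + g) h = D.mul f h + D.mul g h :=
  congrArg (fun φ => φ h) (map_add D.leftMul f g)

theorem mul_assoc' (f g h : OreCarrier n R) :
    D.mul (D.mul f g) h = D.mul f (D.mul g h) :=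
  congrArg (fun φ => φ h) (D.leftMul_mul f g)

theorem mul_single (t : Expo n) (r : R) (f : OreCarrier n R) :
    D.mul (Finsupp.single t r) f = r • D.powY t f := by
  rw [mul, leftMul_single]; rfl

theorem C_mul (r : R) (f : OreCarrier n R) : D.mul (Finsupp.single 0 r) f = r • f := by
  rw [mul_single, powY_zero]; rfl

theorem smul_mul (r : R) (f g : OreCarrier n R) : D.mul (r • f) g = r • D.mul f g := by
  rw [← C_mul, mul_assoc', C_mul]

/-- The embedding of the coefficient ring. -/
noncomputable def C : R →+* OreExt D where
  toFun r := (Finsupp.single 0 r : OreCarrier n R)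
  map_one' := rfl
  map_zero' := Finsupp.single_zero _
  map_add' _ _ := Finsupp.single_add _ _ _
  map_mul' r s := by
    refine Eq.symm ((D.C_mul r _).trans ?_)
    rw [Finsupp.smul_single, smul_eq_mul]

/-- The ring `R̂` of the elements of `R` which are central in the Ore extension. -/
noncomputable def hat : Subring R := (Subring.center (OreExt D)).comap D.C

theorem mem_hat {a : R} : a ∈ D.hat ↔
    ∀ f : OreCarrier n R, D.mul f (Finsupp.single 0 a) = D.mul (Finsupp.single 0 a) f :=
  Subring.mem_center_iff

theorem mul_smul_of_mem_hat {a : R} (ha : a ∈ D.hat) (f g : OreCarrier n R) :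
    D.mul f (a • g) = a • D.mul f g := by
  rw [← C_mul D a g, ← mul_assoc', D.mem_hat.1 ha, mul_assoc', C_mul]

theorem mem_hat_iff {a : R} : a ∈ D.hat ↔
    (∀ r, r * a = a * r) ∧ (∀ i, D.α i a = a) ∧ ∀ i, D.δ i a = 0 := by
  constructor
  · intro ha
    have h1 : ∀ r, r * a = a * r := fun r => by
      have h := D.mem_hat.1 ha (Finsupp.single 0 r)
      rw [C_mul, C_mul, Finsupp.smul_single, Finsupp.smul_single] at h
      exact Finsupp.single_injective 0 h
    have h2 : ∀ i, Finsupp.single (Finsupp.single i 1 : Expo n) (D.α i a) +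
        Finsupp.single 0 (D.δ i a) = Finsupp.single (Finsupp.single i 1) a := fun i => by
      have h := D.mem_hat.1 ha (Finsupp.single (Finsupp.single i 1) 1)
      rw [C_mul, mul_single, one_smul, powY_single, stepY_single, Finsupp.smul_single,
        smul_eq_mul, mul_one, zero_add] at h
      exact h
    have h0 : ∀ i : Fin n, (Finsupp.single i 1 : Expo n) ≠ 0 := fun i => by simp
    refine ⟨h1, fun i => ?_, fun i => ?_⟩
    · have h := DFunLike.congr_fun (h2 i) (Finsupp.single i 1)
      simpa [Finsupp.single_apply, (h0 i).symm] using h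
    · have h := DFunLike.congr_fun (h2 i) 0
      simpa [Finsupp.single_apply, h0 i] using h
  · rintro ⟨h1, h2, h3⟩
    have hs : ∀ i, Commute (coef a) (D.stepY i) := fun i => by
      have h := D.stepY_coef i a
      rw [h2, h3, map_zero, add_zero] at h
      exact h.symm
    have hp : ∀ t, Commute (coef a) (D.powY t) := fun t => by
      refine Commute.list_prod_right _ _ fun x hx => ?_
      obtain ⟨j, -, rfl⟩ := List.mem_map.1 hx
      exact (hs j).pow_right _
    refine D.mem_hat.2 fun f => ?_
    rw [C_mul]
    induction f using Finsupp.induction_linear with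
    | zero => rw [smul_zero, mul, map_zero]; rfl
    | add f g hf hg => rw [mul_add_left, hf, hg, smul_add]
    | single t r =>
      have h := congrArg (fun φ => φ (Finsupp.single 0 1)) (hp t).eq
      simp only [end_mul_apply, coef_apply, powY_one, Finsupp.smul_single, smul_eq_mul,
        mul_one] at h
      rw [mul_single, ← h, Finsupp.smul_single, Finsupp.smul_single, smul_eq_mul, smul_eq_mul,
        h1]

theorem hat_le_hat_graded : D.hat ≤ D.graded.hat := by
  intro a ha
  rw [mem_hat_iff] at ha ⊢
  exact ⟨ha.1, ha.2.1, fun _ => rfl⟩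

noncomputable instance : CommRing D.hat :=
  { (inferInstance : Ring D.hat) with
    mul_comm := fun a b => Subtype.ext ((D.mem_hat_iff.1 b.2).1 a) }

end OreData

/-- The terms `t eᵢ` of `𝒯^{(m)}`. -/
@[ext]
structure Term (n m : ℕ) where
  pos : Fin m
  exp : Expo n

/-- `l ∘ t ∘ r` for `t ∈ 𝒯^{(m)}` and `l, r ∈ 𝒯`. -/
noncomputable def Term.shift {n m : ℕ} (l r : Expo n) (t : Term n m) : Term n m :=
  ⟨t.pos, l + t.exp + r⟩

/-- The linear order on `𝒯^{(m)}` is a term ordering compatible with the term ordering `ord`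
on `𝒯`. -/
structure IsTermOrdering {n : ℕ} (m : ℕ) (ord : MonomialOrder (Fin n))
    [LinearOrder (Term n m)] : Prop where
  wf : WellFoundedLT (Term n m)
  compatible : ∀ (w₁ w₂ : Expo n) (t : Term n m), ord.toSyn w₁ < ord.toSyn w₂ →
    t.shift w₁ 0 < t.shift w₂ 0
  shift_lt : ∀ (w : Expo n) (t₁ t₂ : Term n m), t₁ < t₂ → t₁.shift w 0 < t₂.shift w 0

/-- The free module of rank `m` (over the Ore extension and over its associated graded). -/
abbrev FreeMod (n m : ℕ) (R : Type*) [Ring R] : Type _ := Fin m → OreCarrier n R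

section Leading

variable {n m : ℕ} {R : Type*} [Ring R]

/-- The monomial `c τ eᵢ`. -/
noncomputable def monomial (c : R) (t : Term n m) : FreeMod n m R :=
  Pi.single t.pos (Finsupp.single t.exp c)

variable [LinearOrder (Term n m)]

/-- The maximal term `𝐓(f)`, with `𝐓(0) = ⊥`. -/
noncomputable def leadTerm (f : FreeMod n m R) : WithBot (Term n m) :=
  Finset.univ.sup fun i => (f i).support.sup fun t => ((⟨i, t⟩ : Term n m) : WithBot (Term n m))

/-- The maximal monomial `𝐌(f)`, with `𝐌(0) = 0`. -/
noncomputable def leadMonomial (f : FreeMod n m R) : FreeMod n m R :=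
  WithBot.recBotCoe 0 (fun t => monomial (f t.pos t.exp) t) (leadTerm f)

/-- `𝐌{A}`, the set of the maximal monomials of the nonzero elements of `A`. -/
def leadMonomials (A : Set (FreeMod n m R)) : Set (FreeMod n m R) :=
  {x | ∃ f ∈ A, f ≠ 0 ∧ x = leadMonomial f}

end Leading

/-- The set of all monomials `c τ eᵢ`, `c ≠ 0`, of the free module. -/
def monomials (n m : ℕ) (R : Type*) [Ring R] : Set (FreeMod n m R) :=
  {x | ∃ (c : R) (t : Term n m), c ≠ 0 ∧ x = monomial c t}

namespace OreData

variable {n m u : ℕ} {R : Type*} [Ring R] (D : OreData n R)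

/-- The product `l f r` for ring elements `l, r` and `f` in the free module. -/
noncomputable def sandwich (l : OreCarrier n R) (f : FreeMod n m R) (r : OreCarrier n R) :
    FreeMod n m R :=
  fun k => D.mul (D.mul l (f k)) r

/-- `𝕀₂(F)`, the bilateral submodule generated by `F`. -/
noncomputable def bimodule (F : Set (FreeMod n m R)) : AddSubgroup (FreeMod n m R) :=
  AddSubgroup.closure {x | ∃ l r, ∃ f ∈ F, x = D.sandwich l f r}

/-- `G` is a bilateral (weak) Gröbner basis of the bilateral module `I`: the set of the maximal
monomials of `I` coincides with `𝐌{𝕀₂(𝐌{G})} = 𝕀₂(𝐌{G}) ∩ {monomials}`, where the bilateral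
module generated by the maximal monomials is taken over the associated graded ring. -/
def IsGroebnerBasis [LinearOrder (Term n m)] (G : Set (FreeMod n m R))
    (I : AddSubgroup (FreeMod n m R)) : Prop :=
  G ⊆ I ∧
  leadMonomials (I : Set (FreeMod n m R)) =
    leadMonomials (D.graded.bimodule (leadMonomials G) : Set (FreeMod n m R)) ∧
  leadMonomials (D.graded.bimodule (leadMonomials G) : Set (FreeMod n m R)) =
    (D.graded.bimodule (leadMonomials G) : Set (FreeMod n m R)) ∩ monomials n m R

/-- `f` has a bilateral (weak) Gröbner representation in terms of `F = {g₁,…,g_u}`: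
`f = ∑ᵢ aᵢλᵢ ⋆ g_{ℓᵢ} ⋆ bᵢρᵢ` with `𝐓(λᵢ ⋆ g_{ℓᵢ} ⋆ ρᵢ) ≤ 𝐓(f)`. -/
def HasGroebnerRep [LinearOrder (Term n m)] (g : Fin u → FreeMod n m R)
    (f : FreeMod n m R) : Prop :=
  ∃ (k : ℕ) (a b : Fin k → R) (lam rho : Fin k → Expo n) (ell : Fin k → Fin u),
    (∀ i, a i ≠ 0 ∧ b i ≠ 0 ∧
      leadTerm (D.sandwich (Finsupp.single (lam i) 1) (g (ell i)) (Finsupp.single (rho i) 1)) ≤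
        leadTerm f) ∧
    f = ∑ i, D.sandwich (Finsupp.single (lam i) (a i)) (g (ell i))
      (Finsupp.single (rho i) (b i))

/-- The underlying `R̂`-module of `𝖱 ⊗_{R̂} 𝖱ᵒᵖ` and of `𝖲 ⊗_{R̂} 𝖲ᵒᵖ`. Passing to the opposite ring
does not change the module; it only enters through the bilateral structure
`l (x ⊗ y) r = l x ⊗ y r` of `tensorAct`. -/
abbrev Enveloping : Type _ := OreCarrier n R ⊗[D.hat] OreCarrier n R

/-- The underlying `R̂`-module of `(𝖱 ⊗ 𝖱ᵒᵖ)^u` and `(𝖲 ⊗ 𝖲ᵒᵖ)^u`; the element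
`aλ e_ℓ bρ` is `aλ ⊗ bρ` in position `ℓ`. -/
abbrev Syz (u : ℕ) : Type _ := Fin u → D.Enveloping

/-- The component in `Rλ ⊗ Rρ ≅ R ⊗_{R̂} R` of an element of the tensor product, for all
`(λ, ρ) ∈ 𝒯 × 𝒯`. -/
noncomputable def component :
    D.Enveloping ≃ₗ[D.hat] (Expo n × Expo n →₀ R ⊗[D.hat] R) :=
  finsuppTensorFinsupp D.hat D.hat R R (Expo n) (Expo n)

section Maps

variable (E : OreData n R) (hE : D.hat ≤ E.hat)

theorem sandwich_smul_right {a : R} (ha : a ∈ E.hat) (l r : OreCarrier n R)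
    (f : FreeMod n m R) : E.sandwich l f (a • r) = a • E.sandwich l f r :=
  funext fun _ => E.mul_smul_of_mem_hat ha _ _

/-- The map `x ⊗ y ↦ x w y`, with the multiplication of `E`. -/
noncomputable def tensorEval (w : FreeMod n m R) : D.Enveloping →ₗ[D.hat] FreeMod n m R :=
  TensorProduct.lift (LinearMap.mk₂ D.hat (fun x y => E.sandwich x w y)
    (fun x x' y => funext fun k => by simp only [sandwich, mul_add_left, Pi.add_apply])
    (fun c x y => funext fun k =>
      (congrArg (fun z => E.mul z y) (E.smul_mul c x (w k))).trans (E.smul_mul c _ y))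
    (fun x y y' => funext fun k => by simp only [sandwich, mul_add_right, Pi.add_apply])
    (fun c x y => sandwich_smul_right E (hE c.2) x y w))

/-- The map `∑ aλ e_ℓ bρ ↦ ∑ aλ w_ℓ bρ`, with the multiplication of `E`. -/
noncomputable def syzEval (w : Fin u → FreeMod n m R) : D.Syz u →ₗ[D.hat] FreeMod n m R :=
  ∑ ell, (D.tensorEval E hE (w ell)).comp (LinearMap.proj ell)

/-- The bilateral structure `x ⊗ y ↦ l x ⊗ y r`, with the multiplication of `E`. -/
noncomputable def tensorAct (l r : OreCarrier n R) : D.Enveloping →ₗ[D.hat] D.Enveloping :=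
  TensorProduct.map
    { toFun := fun x => E.mul l x
      map_add' := E.mul_add_right l
      map_smul' := fun c x => E.mul_smul_of_mem_hat (hE c.2) l x }
    { toFun := fun y => E.mul y r
      map_add' := fun y y' => E.mul_add_left y y' r
      map_smul' := fun c y => E.smul_mul c y r }

end Maps

/-- `𝔖₂ : ∑ aλ e_ℓ bρ ↦ ∑ aλ ⋆ g_ℓ ⋆ bρ`. -/
noncomputable def bigS (g : Fin u → FreeMod n m R) : D.Syz u →ₗ[D.hat] FreeMod n m R :=
  D.syzEval D le_rfl g

variable [LinearOrder (Term n m)]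

/-- `𝔰₂ : ∑ aλ e_ℓ bρ ↦ ∑ aλ ∗ 𝐌(g_ℓ) ∗ bρ`. -/
noncomputable def smallS (g : Fin u → FreeMod n m R) : D.Syz u →ₗ[D.hat] FreeMod n m R :=
  D.syzEval D.graded D.hat_le_hat_graded fun ell => leadMonomial (g ell)

/-- The degree `λ ∘ 𝐓(g_ℓ) ∘ ρ` of `aλ e_ℓ bρ`. -/
noncomputable def degree (g : Fin u → FreeMod n m R) (ell : Fin u) (p : Expo n × Expo n) :
    WithBot (Term n m) :=
  (leadTerm (g ell)).map (Term.shift p.1 p.2)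

/-- The valuation `v(σ)`, with `v(0) = ⊥`. -/
noncomputable def val (g : Fin u → FreeMod n m R) (s : D.Syz u) : WithBot (Term n m) :=
  Finset.univ.sup fun ell => (D.component (s ell)).support.sup (degree g ell)

/-- `σ` is `𝒯^{(m)}`-homogeneous. -/
def IsHomogeneous (g : Fin u → FreeMod n m R) (s : D.Syz u) : Prop :=
  ∃ d : WithBot (Term n m), ∀ ell p, D.component (s ell) p ≠ 0 → degree g ell p = d

open Classical in
/-- The leading form `ℒ₂(σ)`: the part of `σ` of degree `v(σ)`. -/
noncomputable def leadForm (g : Fin u → FreeMod n m R) (s : D.Syz u) : D.Syz u :=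
  fun ell => D.component.symm
    ((D.component (s ell)).filter fun p => degree g ell p = D.val g s)

/-- `σ` has a lifting. -/
def HasLifting (g : Fin u → FreeMod n m R) (s : D.Syz u) : Prop :=
  ∃ U : D.Syz u, D.bigS g U = 0 ∧ D.leadForm g U = s

/-- `𝔖₂(σ)` has a bilateral quasi-Gröbner representation `∑ᵢ aᵢλᵢ ⋆ g_{ℓᵢ} ⋆ bᵢρᵢ`, where
`λᵢ ∘ 𝐓(g_{ℓᵢ}) ∘ ρᵢ < v(σ)`. -/
def HasQuasiGroebnerRep (g : Fin u → FreeMod n m R) (s : D.Syz u) : Prop :=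
  ∃ (k : ℕ) (a b : Fin k → R) (lam rho : Fin k → Expo n) (ell : Fin k → Fin u),
    (∀ i, a i ≠ 0 ∧ b i ≠ 0 ∧ degree g (ell i) (lam i, rho i) < D.val g s) ∧
    D.bigS g s = ∑ i, D.sandwich (Finsupp.single (lam i) (a i)) (g (ell i))
      (Finsupp.single (rho i) (b i))

/-- `GM` is a bilateral Gebauer–Möller set: homogeneous elements which generate `ker 𝔰₂` as a
bilateral module over the associated graded ring. -/
def IsGebauerMoeller (g : Fin u → FreeMod n m R) (GM : Set (D.Syz u)) : Prop :=
  (∀ s ∈ GM, D.IsHomogeneous g s) ∧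
  (AddSubgroup.closure {x : D.Syz u | ∃ l r, ∃ s ∈ GM,
      x = fun ell => D.tensorAct D.graded D.hat_le_hat_graded l r (s ell)} : Set (D.Syz u)) =
    {s | D.smallS g s = 0}

end OreData

/-! The maps 𝔖₂ and 𝔰₂ have the same source, and everything rests on comparing them degree by
degree. On monomials, `⋆` and `∗` have the same top coefficient and differ only in terms strictly
dividing the top one. Together with the tails of the g_ℓ, this shows that 𝔖₂(σ) − 𝔰₂(σ) involves
only terms strictly below degrees of components of σ (`bigS_sub_smallS_apply_ne_zero`), while 𝔰₂
preserves degrees (`smallS_apply_ne_zero`). So if v(σ) ≤ t, the coefficient of 𝔖₂(σ) at t is that of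
𝔰₂ on the degree-t part of σ.

Injectivity of the αᵢ gives 𝐓(λ⋆g⋆ρ) = λ∘𝐓(g)∘ρ (`leadTerm_sandwich`), so a Gröbner representation
of f is a preimage of f under 𝔖₂ of valuation at most 𝐓(f). For a Gröbner basis, division produces
such preimages (`exists_val_le_of_leadMonomial`); conversely their top parts identify the leading
monomials of the module (`leadMonomials_bimodule`). If σ is homogeneous in ker 𝔰₂, then 𝔖₂(σ) lies
below the degree of σ, and subtracting a Gröbner representation of it lifts σ
(`liftsBelow_of_exists_val_le`). Conversely, a preimage whose valuation exceeds 𝐓(f) has its leading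
form in ker 𝔰₂; subtracting a lifting lowers the valuation, and the well-ordering stops the process
(`exists_val_le_of_liftsBelow`).

Liftings extend from generators to the kernel because `LiftsBelow` is additive and survives the
bilateral action: the actions of 𝖱 and 𝖲 agree up to lower degree (`liftsBelow_homPart_syzAct`).
Finally, a quasi-Gröbner representation τ of 𝔖₂(σ) and a lifting U of σ correspond through U = σ −
τ. -/

namespace OreData

/-! ### Supports of products in the Ore extension and its graded companion. -/

variable {n m u : ℕ} {R : Type*} [Ring R] (D : OreData n R)

/-- The monomials of `Y^l (r t)` divide `l + t`, and the coefficient of `l + t` is the image of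
`r` under an injective endomorphism which does not depend on the derivations. -/
theorem exists_powY_single (l : Expo n) : ∃ φ : R →+* R, Function.Injective φ ∧ ∀ t r,
    D.graded.powY l (Finsupp.single t r) = Finsupp.single (l + t) (φ r) ∧
    ∀ s, (D.powY l (Finsupp.single t r) - Finsupp.single (l + t) (φ r)) s ≠ 0 → s < l + t := by
  induction l using Finsupp.induction_linear with
  | zero =>
    refine ⟨RingHom.id R, Function.injective_id, fun t r => ?_⟩
    simp [powY_zero]
  | add l l' h h' =>
    obtain ⟨φ, hφ, H⟩ := h
    obtain ⟨ψ, hψ, H'⟩ := h'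
    refine ⟨φ.comp ψ, hφ.comp hψ, fun t r => ⟨?_, fun s hs => ?_⟩⟩
    · rw [powY_add, end_mul_apply, (H' t r).1, (H _ _).1, add_assoc]; rfl
    · have key : ∀ f : OreCarrier n R, (∀ s, f s ≠ 0 → s < l' + t) →
          ∀ s, D.powY l f s ≠ 0 → s < l + (l' + t) := by
        intro f hf s hs
        by_contra hlt
        apply hs
        rw [← Finsupp.sum_single f, Finsupp.sum, map_sum, Finsupp.finsetSum_apply]
        refine Finset.sum_eq_zero fun v hv => ?_
        by_contra h0
        refine hlt (lt_of_le_of_lt ?_ (add_lt_add_right (hf v (Finsupp.mem_support_iff.1 hv)) l))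
        by_cases h1 : s = l + v
        · exact h1.le
        · refine ((H v (f v)).2 s ?_).le
          rwa [Finsupp.sub_apply, Finsupp.single_eq_of_ne h1, sub_zero]
      -- The total error is `Y^l` applied to the error of the inner factor, handled by `key`, plus
      -- the error of `Y^l` on the inner top monomial.
      rw [powY_add, end_mul_apply, ← sub_add_cancel (D.powY l' (Finsupp.single t r))
        (Finsupp.single (l' + t) (ψ r)), map_add, add_assoc l l' t, add_sub_assoc] at hs
      rw [add_assoc]
      by_cases h1 : D.powY l (D.powY l' (Finsupp.single t r) - Finsupp.single (l' + t) (ψ r)) s = 0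
      · rw [Finsupp.add_apply, h1, zero_add] at hs
        exact (H _ _).2 s hs
      · exact key _ (H' t r).2 s h1
  | single i k =>
    induction k with
    | zero =>
      refine ⟨RingHom.id R, Function.injective_id, fun t r => ?_⟩
      simp [powY_zero]
    | succ k ih =>
      obtain ⟨φ, hφ, H⟩ := ih
      refine ⟨(D.α i).comp φ, (D.α_injective i).comp hφ, fun t r => ?_⟩
      have e : Finsupp.single i (k + 1) + t = Finsupp.single i k + t + Finsupp.single i 1 := by
        rw [Finsupp.single_add]; abel
      have hi : ∀ v : Expo n, v < v + Finsupp.single i 1 := fun v =>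
        lt_add_of_pos_right _ (by simp [pos_iff_ne_zero])
      have hst : ∀ E : OreData n R, E.powY (Finsupp.single i (k + 1)) (Finsupp.single t r) =
          E.stepY i (E.powY (Finsupp.single i k) (Finsupp.single t r)) := fun E => by
        rw [add_comm k, Finsupp.single_add, powY_add, powY_single, end_mul_apply]
      have key : ∀ (f : OreCarrier n R) v, (∀ s, f s ≠ 0 → s < v) →
          ∀ s, D.stepY i f s ≠ 0 → s < v + Finsupp.single i 1 := by
        intro f v hf s hs
        by_contra hlt
        apply hs
        rw [← Finsupp.sum_single f, Finsupp.sum, map_sum, Finsupp.finsetSum_apply]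
        refine Finset.sum_eq_zero fun w hw => ?_
        have hw' := hf w (Finsupp.mem_support_iff.1 hw)
        rw [stepY_single, Finsupp.add_apply, Finsupp.single_eq_of_ne, Finsupp.single_eq_of_ne,
          add_zero]
        · rintro rfl
          exact hlt (hw'.trans (hi v))
        · rintro rfl
          exact hlt (add_lt_add_left hw' _)
      rw [hst, hst, e, (H t r).1, stepY_single]
      refine ⟨by simp [graded], fun s hs => ?_⟩
      rw [← sub_add_cancel (D.powY (Finsupp.single i k) (Finsupp.single t r))
        (Finsupp.single (Finsupp.single i k + t) (φ r)), map_add, stepY_single] at hs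
      by_cases h1 : D.stepY i (D.powY (Finsupp.single i k) (Finsupp.single t r) -
          Finsupp.single (Finsupp.single i k + t) (φ r)) s = 0
      · by_cases h2 : s = Finsupp.single i k + t
        · exact h2 ▸ hi _
        · refine absurd ?_ hs
          simp only [Finsupp.sub_apply, Finsupp.add_apply] at h1 ⊢
          rw [h1, Finsupp.single_eq_of_ne h2]
          simp
      · exact key _ _ (H t r).2 s h1

theorem mul_sum_single (f h : OreCarrier n R) : D.mul f h =
    ∑ a ∈ f.support, ∑ b ∈ h.support, f a • D.powY a (Finsupp.single b (h b)) := by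
  conv_lhs => rw [mul, ← Finsupp.sum_single f, Finsupp.sum, map_sum]
  refine (AddMonoidHom.finsetSum_apply
    (fun a => (D.leftMul (Finsupp.single a (f a)) : OreCarrier n R →+ OreCarrier n R))
    f.support h).trans ?_
  refine Finset.sum_congr rfl fun a _ => ?_
  rw [leftMul_single, ← Finset.smul_sum, ← map_sum]
  exact congrArg (fun x => f a • D.powY a x) (Finsupp.sum_single h).symm

theorem exists_of_sum_apply_ne_zero {f h : OreCarrier n R} {G : Expo n → Expo n → OreCarrier n R}
    {s : Expo n} (H : (∑ a ∈ f.support, ∑ b ∈ h.support, G a b) s ≠ 0) :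
    ∃ a b, f a ≠ 0 ∧ h b ≠ 0 ∧ G a b s ≠ 0 := by
  rw [Finsupp.finsetSum_apply] at H
  obtain ⟨a, ha, H⟩ := Finset.exists_ne_zero_of_sum_ne_zero H
  rw [Finsupp.finsetSum_apply] at H
  obtain ⟨b, hb, H⟩ := Finset.exists_ne_zero_of_sum_ne_zero H
  exact ⟨a, b, Finsupp.mem_support_iff.1 ha, Finsupp.mem_support_iff.1 hb, H⟩

theorem graded_mul_apply_ne_zero {f h : OreCarrier n R} {s : Expo n}
    (H : D.graded.mul f h s ≠ 0) : ∃ a b, f a ≠ 0 ∧ h b ≠ 0 ∧ s = a + b := by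
  rw [mul_sum_single] at H
  obtain ⟨a, b, ha, hb, H⟩ := exists_of_sum_apply_ne_zero H
  refine ⟨a, b, ha, hb, ?_⟩
  obtain ⟨φ, -, hφ⟩ := D.exists_powY_single a
  by_contra hs
  rw [(hφ b (h b)).1, Finsupp.smul_single, Finsupp.single_eq_of_ne hs] at H
  exact H rfl

/-- The top coefficients cancel, being given by the same endomorphism; what remains comes from the
derivations, which lower the exponent. -/
theorem mul_sub_graded_mul_apply_ne_zero {f h : OreCarrier n R} {s : Expo n}
    (H : (D.mul f h - D.graded.mul f h) s ≠ 0) : ∃ a b, f a ≠ 0 ∧ h b ≠ 0 ∧ s < a + b := by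
  simp only [mul_sum_single, ← Finset.sum_sub_distrib, ← smul_sub] at H
  obtain ⟨a, b, ha, hb, H⟩ := exists_of_sum_apply_ne_zero H
  refine ⟨a, b, ha, hb, ?_⟩
  obtain ⟨φ, -, hφ⟩ := D.exists_powY_single a
  rw [(hφ b (h b)).1] at H
  exact (hφ b (h b)).2 s fun h0 => H (by rw [Finsupp.smul_apply, h0, smul_zero])

theorem mul_apply_ne_zero {f h : OreCarrier n R} {s : Expo n}
    (H : D.mul f h s ≠ 0) : ∃ a b, f a ≠ 0 ∧ h b ≠ 0 ∧ s ≤ a + b := by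
  by_cases h1 : D.graded.mul f h s = 0
  · obtain ⟨a, b, ha, hb, h⟩ := D.mul_sub_graded_mul_apply_ne_zero (f := f) (h := h) (s := s)
      (by rwa [Finsupp.sub_apply, h1, sub_zero])
    exact ⟨a, b, ha, hb, h.le⟩
  · obtain ⟨a, b, ha, hb, h⟩ := D.graded_mul_apply_ne_zero h1
    exact ⟨a, b, ha, hb, h.le⟩

theorem graded_sandwich_apply_ne_zero {l r : OreCarrier n R} {f : FreeMod n m R} {k : Fin m}
    {s : Expo n} (H : D.graded.sandwich l f r k s ≠ 0) :
    ∃ a b c, l a ≠ 0 ∧ f k b ≠ 0 ∧ r c ≠ 0 ∧ s = a + b + c := by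
  obtain ⟨x, c, hx, hc, rfl⟩ := D.graded_mul_apply_ne_zero H
  obtain ⟨a, b, ha, hb, rfl⟩ := D.graded_mul_apply_ne_zero hx
  exact ⟨a, b, c, ha, hb, hc, rfl⟩

theorem sandwich_apply_ne_zero {l r : OreCarrier n R} {f : FreeMod n m R} {k : Fin m}
    {s : Expo n} (H : D.sandwich l f r k s ≠ 0) :
    ∃ a b c, l a ≠ 0 ∧ f k b ≠ 0 ∧ r c ≠ 0 ∧ s ≤ a + b + c := by
  obtain ⟨x, c, hx, hc, hs⟩ := D.mul_apply_ne_zero H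
  obtain ⟨a, b, ha, hb, hs'⟩ := D.mul_apply_ne_zero hx
  exact ⟨a, b, c, ha, hb, hc, hs.trans (add_le_add_left hs' c)⟩

theorem sandwich_sub_graded_apply_ne_zero {l r : OreCarrier n R} {f : FreeMod n m R} {k : Fin m}
    {s : Expo n} (H : (D.sandwich l f r k - D.graded.sandwich l f r k) s ≠ 0) :
    ∃ a b c, l a ≠ 0 ∧ f k b ≠ 0 ∧ r c ≠ 0 ∧ s < a + b + c := by
  -- The two products are exchanged one at a time, the outer one first.
  have e : D.sandwich l f r k - D.graded.sandwich l f r k =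
      (D.mul (D.mul l (f k)) r - D.graded.mul (D.mul l (f k)) r) +
        D.graded.mul (D.mul l (f k) - D.graded.mul l (f k)) r := by
    have h := D.graded.mul_add_left (D.mul l (f k) - D.graded.mul l (f k))
      (D.graded.mul l (f k)) r
    rw [sub_add_cancel] at h
    rw [h]
    unfold sandwich
    abel
  by_cases h1 : (D.mul (D.mul l (f k)) r - D.graded.mul (D.mul l (f k)) r) s = 0
  · rw [e, Finsupp.add_apply, h1, zero_add] at H
    obtain ⟨x, c, hx, hc, rfl⟩ := D.graded_mul_apply_ne_zero H
    obtain ⟨a, b, ha, hb, hs⟩ := D.mul_sub_graded_mul_apply_ne_zero hx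
    exact ⟨a, b, c, ha, hb, hc, add_lt_add_left hs c⟩
  · obtain ⟨x, c, hx, hc, hs⟩ := D.mul_sub_graded_mul_apply_ne_zero h1
    obtain ⟨a, b, ha, hb, hs'⟩ := D.mul_apply_ne_zero hx
    exact ⟨a, b, c, ha, hb, hc, hs.trans_le (add_le_add_left hs' c)⟩

theorem sandwich_add (l r : OreCarrier n R) (f f' : FreeMod n m R) :
    D.sandwich l (f + f') r = D.sandwich l f r + D.sandwich l f' r :=
  funext fun k => by simp only [sandwich, Pi.add_apply, mul_add_left, mul_add_right]

/-- The coefficient is `φ c` with `φ` injective; the right factor has coefficient 1, which is fixed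
by every endomorphism. -/
theorem graded_sandwich_monomial_apply_ne_zero (l r : Expo n) {c : R} (hc : c ≠ 0)
    (t : Term n m) : D.graded.sandwich (Finsupp.single l 1) (monomial c t) (Finsupp.single r 1)
      t.pos (l + t.exp + r) ≠ 0 := by
  obtain ⟨φ, hφ, H⟩ := D.exists_powY_single l
  obtain ⟨ψ, -, H'⟩ := D.exists_powY_single (l + t.exp)
  simp only [sandwich, monomial, Pi.single_eq_same, mul_single, one_smul]
  rw [(H _ _).1, mul_single, (H' _ _).1, map_one, Finsupp.smul_single, Finsupp.single_eq_same,
    smul_eq_mul, mul_one]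
  exact (map_ne_zero_iff φ hφ).2 hc

end OreData

/-! ### Leading terms, leading monomials and the term ordering. -/

section Leading

variable {n m : ℕ} {R : Type*} [Ring R]

theorem monomial_apply_self (c : R) (t : Term n m) : monomial c t t.pos t.exp = c := by
  simp [monomial]

theorem eq_of_monomial_apply_ne_zero {c : R} {t : Term n m} {k : Fin m} {s : Expo n}
    (h : monomial c t k s ≠ 0) : (⟨k, s⟩ : Term n m) = t := by
  by_cases hk : k = t.pos
  · subst hk
    by_cases hs : s = t.exp
    · subst hs; rfl
    · exact absurd (by simp [monomial, Finsupp.single_eq_of_ne hs]) h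
  · exact absurd (by simp [monomial, Pi.single_eq_of_ne hk]) h

theorem eq_monomial {f : FreeMod n m R} {t : Term n m}
    (h : ∀ k s, f k s ≠ 0 → (⟨k, s⟩ : Term n m) = t) : f = monomial (f t.pos t.exp) t := by
  ext k s
  by_cases hks : (⟨k, s⟩ : Term n m) = t
  · subst hks; rw [monomial_apply_self]
  · rw [not_not.1 fun h0 => hks (h k s h0),
      not_not.1 fun h0 => hks (eq_of_monomial_apply_ne_zero h0)]

variable [LinearOrder (Term n m)]

theorem leadTerm_le_iff {f : FreeMod n m R} {d : WithBot (Term n m)} :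
    leadTerm f ≤ d ↔ ∀ k s, f k s ≠ 0 → ((⟨k, s⟩ : Term n m) : WithBot (Term n m)) ≤ d := by
  simp [leadTerm, Finset.sup_le_iff]

theorem le_leadTerm {f : FreeMod n m R} {k : Fin m} {s : Expo n} (h : f k s ≠ 0) :
    ((⟨k, s⟩ : Term n m) : WithBot (Term n m)) ≤ leadTerm f :=
  leadTerm_le_iff.1 le_rfl k s h

theorem exists_leadTerm {f : FreeMod n m R} (hf : f ≠ 0) :
    ∃ t : Term n m, leadTerm f = t ∧ f t.pos t.exp ≠ 0 := by
  have hb : ⊥ < leadTerm f := by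
    obtain ⟨k, hk⟩ := Function.ne_iff.1 hf
    obtain ⟨s, hs⟩ := DFunLike.ne_iff.1 hk
    exact (WithBot.bot_lt_coe _).trans_le (le_leadTerm hs)
  by_contra! H
  refine lt_irrefl (leadTerm f) ?_
  conv_lhs => rw [leadTerm]
  refine (Finset.sup_lt_iff hb).2 fun k _ => (Finset.sup_lt_iff hb).2 fun s hs => ?_
  have hs' := Finsupp.mem_support_iff.1 hs
  exact lt_of_le_of_ne (le_leadTerm hs') fun h => hs' (H ⟨k, s⟩ h.symm)

theorem leadTerm_eq {f : FreeMod n m R} {t : Term n m} (h : f t.pos t.exp ≠ 0)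
    (H : ∀ k s, f k s ≠ 0 → (⟨k, s⟩ : Term n m) ≤ t) : leadTerm f = t :=
  le_antisymm (leadTerm_le_iff.2 fun k s hks => WithBot.coe_le_coe.2 (H k s hks)) (le_leadTerm h)

theorem leadMonomial_eq {f : FreeMod n m R} {t : Term n m} (h : leadTerm f = t) :
    leadMonomial f = monomial (f t.pos t.exp) t := by
  rw [leadMonomial, h]; rfl

theorem leadMonomial_monomial {c : R} (hc : c ≠ 0) (t : Term n m) :
    leadMonomial (monomial c t) = monomial c t := by
  rw [leadMonomial_eq (leadTerm_eq (by rwa [monomial_apply_self]) fun k s h =>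
    (eq_of_monomial_apply_ne_zero h).le), monomial_apply_self]

variable {ord : MonomialOrder (Fin n)} (hord : IsTermOrdering m ord)
include hord

/-- A monomial order refines divisibility, and compatibility carries this to each position. Thus the
exponent drops caused by derivations become drops in the term ordering. -/
theorem IsTermOrdering.lt_of_exp_lt (k : Fin m) {s s' : Expo n} (h : s < s') :
    (⟨k, s⟩ : Term n m) < ⟨k, s'⟩ := by
  simpa [Term.shift] using hord.compatible s s' ⟨k, 0⟩ (ord.toSyn_strictMono h)

theorem IsTermOrdering.le_of_exp_le (k : Fin m) {s s' : Expo n} (h : s ≤ s') :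
    (⟨k, s⟩ : Term n m) ≤ ⟨k, s'⟩ := by
  rcases h.eq_or_lt with rfl | h
  exacts [le_rfl, (hord.lt_of_exp_lt k h).le]

theorem IsTermOrdering.shift_strictMono (l r : Expo n) :
    StrictMono (Term.shift l r : Term n m → Term n m) := fun t t' h => by
  have := hord.shift_lt (l + r) t t' h
  simpa only [Term.shift, add_zero, add_right_comm l r] using this

end Leading

/-! ### Elementary tensors, evaluation maps and the bilateral action. -/

namespace OreData

variable {n m u : ℕ} {R : Type*} [Ring R] (D : OreData n R)

theorem component_tmul (x y : OreCarrier n R) (p : Expo n × Expo n) :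
    D.component (x ⊗ₜ y) p = x p.1 ⊗ₜ y p.2 :=
  finsuppTensorFinsupp_apply ..

/-- The element `aλ e_ℓ bρ`, for `p = (λ, ρ)`. -/
noncomputable def elementary (ell : Fin u) (p : Expo n × Expo n) (a b : R) : D.Syz u :=
  Pi.single ell (Finsupp.single p.1 a ⊗ₜ Finsupp.single p.2 b)

theorem syz_ext {s t : D.Syz u}
    (h : ∀ ell p, D.component (s ell) p = D.component (t ell) p) : s = t :=
  funext fun ell => D.component.injective (Finsupp.ext (h ell))

theorem component_elementary {ell ell' : Fin u} {p p' : Expo n × Expo n} {a b : R}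
    (h : D.component (D.elementary ell p a b ell') p' ≠ 0) : ell' = ell ∧ p' = p := by
  by_cases he : ell' = ell
  · subst he
    refine ⟨rfl, ?_⟩
    rw [elementary, Pi.single_eq_same, component_tmul] at h
    refine Prod.ext ?_ ?_ <;> by_contra h0
    · exact h (by rw [Finsupp.single_eq_of_ne h0, TensorProduct.zero_tmul])
    · exact h (by rw [Finsupp.single_eq_of_ne h0, TensorProduct.tmul_zero])
  · exact absurd (by rw [elementary, Pi.single_eq_of_ne he, map_zero]; rfl) h

/-- An element is a sum of elements `aλ e_ℓ bρ` lying in its nonzero components. -/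
theorem syz_induction {P : Fin u → Expo n × Expo n → Prop} {motive : D.Syz u → Prop}
    {s : D.Syz u} (hs : ∀ ell p, D.component (s ell) p ≠ 0 → P ell p) (zero : motive 0)
    (add : ∀ x y, motive x → motive y → motive (x + y))
    (elem : ∀ ell p a b, P ell p → a ≠ 0 → b ≠ 0 → motive (D.elementary ell p a b)) :
    motive s := by
  rw [← Finset.univ_sum_single s]
  refine Finset.sum_induction _ motive add zero fun ell _ => ?_
  have e : Pi.single ell (s ell) = ∑ p ∈ (D.component (s ell)).support,
      (Pi.single ell (D.component.symm (Finsupp.single p (D.component (s ell) p))) : D.Syz u) := by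
    conv_lhs => rw [← D.component.symm_apply_apply (s ell),
      ← Finsupp.sum_single (D.component (s ell)), Finsupp.sum, map_sum]
    exact map_sum (AddMonoidHom.single (fun _ : Fin u => D.Enveloping) ell) _ _
  rw [e]
  refine Finset.sum_induction _ motive add zero fun p hp => ?_
  have hP := hs ell p (Finsupp.mem_support_iff.1 hp)
  generalize D.component (s ell) p = x
  induction x using TensorProduct.induction_on with
  | zero => simpa using zero
  | add x y hx hy => rw [Finsupp.single_add, map_add, Pi.single_add]; exact add _ _ hx hy
  | tmul a b =>
    rw [component, finsuppTensorFinsupp_symm_single]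
    -- A pure tensor with a zero factor is zero, so only nonzero coefficients reach `elem`, as the
    -- definitions of representations demand.
    by_cases ha : a = 0
    · simpa [ha] using zero
    by_cases hb : b = 0
    · simpa [hb] using zero
    exact elem ell p a b hP ha hb

/-- The contrapositive of `syz_induction`: support questions about additive maps reduce to a single
elementary tensor, located in a nonzero component of `s`. -/
theorem exists_of_map_ne {A : Type*} [AddCommMonoid A] (φ ψ : D.Syz u →+ A) {s : D.Syz u}
    (h : φ s ≠ ψ s) : ∃ ell p a b, D.component (s ell) p ≠ 0 ∧
      φ (D.elementary ell p a b) ≠ ψ (D.elementary ell p a b) := by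
  by_contra! H
  refine h (D.syz_induction (motive := fun s => φ s = ψ s)
    (P := fun ell p => D.component (s ell) p ≠ 0) (fun _ _ h => h) (by rw [map_zero, map_zero])
    (fun x y hx hy => by rw [map_add, map_add, hx, hy]) fun ell p a b hp _ _ => H ell p a b hp)

theorem exists_of_map_ne_zero {A : Type*} [AddCommMonoid A] (φ : D.Syz u →+ A) {s : D.Syz u}
    (h : φ s ≠ 0) : ∃ ell p a b, D.component (s ell) p ≠ 0 ∧ φ (D.elementary ell p a b) ≠ 0 :=
  D.exists_of_map_ne φ 0 h

/-- Translates degree conditions on tensors into the explicit indexed sums of the definitions of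
representations. -/
theorem exists_sum_elementary {P : Fin u → Expo n × Expo n → Prop} {s : D.Syz u}
    (hs : ∀ ell p, D.component (s ell) p ≠ 0 → P ell p) :
    ∃ (k : ℕ) (a b : Fin k → R) (lam rho : Fin k → Expo n) (ell : Fin k → Fin u),
      (∀ i, a i ≠ 0 ∧ b i ≠ 0 ∧ P (ell i) (lam i, rho i)) ∧
      s = ∑ i, D.elementary (ell i) (lam i, rho i) (a i) (b i) := by
  refine D.syz_induction (motive := fun s => ∃ (k : ℕ) (a b : Fin k → R)
    (lam rho : Fin k → Expo n) (ell : Fin k → Fin u),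
      (∀ i, a i ≠ 0 ∧ b i ≠ 0 ∧ P (ell i) (lam i, rho i)) ∧
      s = ∑ i, D.elementary (ell i) (lam i, rho i) (a i) (b i)) hs ?_ ?_ ?_
  · exact ⟨0, Fin.elim0, Fin.elim0, Fin.elim0, Fin.elim0, Fin.elim0, fun i => i.elim0, by simp⟩
  · rintro _ _ ⟨k, a, b, lam, rho, ell, h, rfl⟩ ⟨k', a', b', lam', rho', ell', h', rfl⟩
    refine ⟨k + k', Fin.append a a', Fin.append b b', Fin.append lam lam', Fin.append rho rho',
      Fin.append ell ell', fun i => ?_, by simp [Fin.sum_univ_add]⟩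
    induction i using Fin.addCases with
    | left i => simpa using h i
    | right i => simpa using h' i
  · intro ell p a b hp ha hb
    exact ⟨1, fun _ => a, fun _ => b, fun _ => p.1, fun _ => p.2, fun _ => ell,
      fun _ => ⟨ha, hb, hp⟩, by simp⟩

theorem exists_of_component_sum_ne_zero {k : ℕ} {a b : Fin k → R} {lam rho : Fin k → Expo n}
    {ell : Fin k → Fin u} {e : Fin u} {p : Expo n × Expo n}
    (h : D.component ((∑ i, D.elementary (ell i) (lam i, rho i) (a i) (b i)) e) p ≠ 0) :
    ∃ i, e = ell i ∧ p = (lam i, rho i) := by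
  rw [Finset.sum_apply, map_sum, Finsupp.finsetSum_apply] at h
  obtain ⟨i, -, hi⟩ := Finset.exists_ne_zero_of_sum_ne_zero h
  exact ⟨i, D.component_elementary hi⟩

theorem sandwich_zero (l r : OreCarrier n R) : D.sandwich l (0 : FreeMod n m R) r = 0 :=
  funext fun _ => (congrArg (fun x => D.mul x r) (map_zero (D.leftMul l))).trans
    (congrArg (fun φ => φ r) (map_zero D.leftMul))

section Maps

variable (E : OreData n R) (hE : D.hat ≤ E.hat)

theorem syzEval_elementary (w : Fin u → FreeMod n m R) (ell : Fin u) (p : Expo n × Expo n)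
    (a b : R) : D.syzEval E hE w (D.elementary ell p a b) =
      E.sandwich (Finsupp.single p.1 a) (w ell) (Finsupp.single p.2 b) := by
  rw [syzEval, LinearMap.sum_apply, Finset.sum_eq_single ell]
  · simp [elementary, tensorEval]
  · intro e _ he
    simp [elementary, Pi.single_eq_of_ne he]
  · simp

/-- The bilateral structure of the module of syzygies. -/
noncomputable def syzAct (l r : OreCarrier n R) : D.Syz u →ₗ[D.hat] D.Syz u :=
  LinearMap.pi fun ell => (D.tensorAct E hE l r).comp (LinearMap.proj ell)

theorem syzAct_elementary (l r : OreCarrier n R) (ell : Fin u) (p : Expo n × Expo n) (a b : R) :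
    D.syzAct E hE l r (D.elementary ell p a b) =
      Pi.single ell (E.mul l (Finsupp.single p.1 a) ⊗ₜ E.mul (Finsupp.single p.2 b) r) := by
  funext e
  by_cases he : e = ell
  · subst he; simp [syzAct, elementary, tensorAct]
  · simp [syzAct, elementary, Pi.single_eq_of_ne he]

/-- Pure tensors evaluate to the generators `l w r`, and evaluation is additive. -/
theorem mem_range_syzEval (w : Fin u → FreeMod n m R) (f : FreeMod n m R) :
    f ∈ E.bimodule (Set.range w) ↔ ∃ s, D.syzEval E hE w s = f := by
  have hsum : ∀ ell x y, D.syzEval E hE w (Pi.single ell (x ⊗ₜ y)) = E.sandwich x (w ell) y := by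
    intro ell x y
    rw [syzEval, LinearMap.sum_apply, Finset.sum_eq_single ell]
    · simp [tensorEval]
    · intro e _ he
      simp [Pi.single_eq_of_ne he]
    · simp
  constructor
  · intro hf
    induction hf using AddSubgroup.closure_induction with
    | mem x hx =>
      obtain ⟨l, r, _, ⟨ell, rfl⟩, rfl⟩ := hx
      exact ⟨Pi.single ell (l ⊗ₜ r), hsum ell l r⟩
    | zero => exact ⟨0, map_zero _⟩
    | add x y _ _ hx hy =>
      obtain ⟨s, rfl⟩ := hx
      obtain ⟨t, rfl⟩ := hy
      exact ⟨s + t, map_add _ _ _⟩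
    | neg x _ hx =>
      obtain ⟨s, rfl⟩ := hx
      exact ⟨-s, map_neg (D.syzEval E hE w) s⟩
  · rintro ⟨s, rfl⟩
    refine D.syz_induction (P := fun _ _ => True)
      (motive := fun s => D.syzEval E hE w s ∈ E.bimodule (Set.range w))
      (fun _ _ _ => trivial) ?_ ?_ ?_
    · rw [map_zero]; exact zero_mem _
    · intro x y hx hy; rw [map_add]; exact add_mem hx hy
    · intro ell p a b _ _ _
      rw [syzEval_elementary]
      exact AddSubgroup.subset_closure ⟨_, _, _, ⟨ell, rfl⟩, rfl⟩

/-- Associativity makes evaluation a bimodule map, so syzygies stay syzygies under the action. -/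
theorem syzEval_syzAct (w : Fin u → FreeMod n m R) (l r : OreCarrier n R) (s : D.Syz u) :
    D.syzEval E hE w (D.syzAct E hE l r s) = E.sandwich l (D.syzEval E hE w s) r := by
  refine D.syz_induction (P := fun _ _ => True) (motive := fun s =>
      D.syzEval E hE w (D.syzAct E hE l r s) = E.sandwich l (D.syzEval E hE w s) r)
    (fun _ _ _ => trivial) ?_ ?_ ?_
  · rw [map_zero, map_zero, sandwich_zero]
  · intro x y hx hy
    rw [map_add, map_add, hx, hy, map_add, sandwich_add]
  · intro ell p a b _ _ _
    rw [syzAct_elementary, syzEval_elementary]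
    rw [syzEval, LinearMap.sum_apply, Finset.sum_eq_single ell]
    · simp only [tensorEval, LinearMap.comp_apply, LinearMap.proj_apply, Pi.single_eq_same,
        TensorProduct.lift.tmul, LinearMap.mk₂_apply]
      funext k
      simp only [sandwich, mul_assoc']
    · intro e _ he
      simp [Pi.single_eq_of_ne he]
    · simp

theorem syzAct_add_left (l l' r : OreCarrier n R) (s : D.Syz u) :
    D.syzAct E hE (l + l') r s = D.syzAct E hE l r s + D.syzAct E hE l' r s := by
  refine D.syz_induction (P := fun _ _ => True) (motive := fun s =>
      D.syzAct E hE (l + l') r s = D.syzAct E hE l r s + D.syzAct E hE l' r s)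
    (fun _ _ _ => trivial) ?_ ?_ ?_
  · simp only [map_zero, add_zero]
  · intro x y hx hy
    rw [map_add, map_add, map_add, hx, hy, add_add_add_comm]
  · intro ell p a b _ _ _
    rw [syzAct_elementary, syzAct_elementary, syzAct_elementary, mul_add_left,
      TensorProduct.add_tmul, Pi.single_add]

theorem syzAct_add_right (l r r' : OreCarrier n R) (s : D.Syz u) :
    D.syzAct E hE l (r + r') s = D.syzAct E hE l r s + D.syzAct E hE l r' s := by
  refine D.syz_induction (P := fun _ _ => True) (motive := fun s =>
      D.syzAct E hE l (r + r') s = D.syzAct E hE l r s + D.syzAct E hE l r' s)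
    (fun _ _ _ => trivial) ?_ ?_ ?_
  · simp only [map_zero, add_zero]
  · intro x y hx hy
    rw [map_add, map_add, map_add, hx, hy, add_add_add_comm]
  · intro ell p a b _ _ _
    rw [syzAct_elementary, syzAct_elementary, syzAct_elementary, mul_add_right,
      TensorProduct.tmul_add, Pi.single_add]

theorem syzAct_one (s : D.Syz u) :
    D.syzAct E hE (Finsupp.single 0 1) (Finsupp.single 0 1) s = s := by
  refine D.syz_induction (P := fun _ _ => True) (motive := fun s =>
      D.syzAct E hE (Finsupp.single 0 1) (Finsupp.single 0 1) s = s)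
    (fun _ _ _ => trivial) (map_zero _) ?_ ?_
  · intro x y hx hy
    rw [map_add, hx, hy]
  · intro ell p a b _ _ _
    rw [syzAct_elementary, C_mul, one_smul, mul_single_one]
    rfl

end Maps

end OreData

/-! ### Removing and recognising the leading monomial. -/

section Leading

variable {n m : ℕ} {R : Type*} [Ring R] [LinearOrder (Term n m)]

theorem sub_leadMonomial_apply_ne_zero {f : FreeMod n m R} {k : Fin m} {s : Expo n}
    (h : (f - leadMonomial f) k s ≠ 0) :
    ((⟨k, s⟩ : Term n m) : WithBot (Term n m)) < leadTerm f := by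
  have hf : f ≠ 0 := by
    rintro rfl
    refine h ?_
    have hb : leadTerm (0 : FreeMod n m R) = ⊥ := le_bot_iff.1 (leadTerm_le_iff.2 fun k s h =>
      absurd rfl h)
    rw [leadMonomial, hb]
    simp
  obtain ⟨t, ht, -⟩ := exists_leadTerm hf
  rw [leadMonomial_eq ht] at h
  by_cases hks : (⟨k, s⟩ : Term n m) = t
  · subst hks
    exact absurd (sub_eq_zero.2 (monomial_apply_self _ _).symm) h
  · have h0 : monomial (f t.pos t.exp) t k s = 0 :=
      not_not.1 fun h1 => hks (eq_of_monomial_apply_ne_zero h1)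
    rw [Pi.sub_apply, Finsupp.sub_apply, h0, sub_zero] at h
    exact lt_of_le_of_ne (le_leadTerm h) (by rw [ht]; exact fun h => hks (WithBot.coe_inj.1 h))

theorem leadMonomial_eq_of_sub {f : FreeMod n m R} {c : R} (hc : c ≠ 0) {t : Term n m}
    (h : ∀ k s, (f - monomial c t) k s ≠ 0 → (⟨k, s⟩ : Term n m) < t) :
    f ≠ 0 ∧ leadMonomial f = monomial c t := by
  have ht : f t.pos t.exp = c := by
    by_contra h0
    refine lt_irrefl t (h t.pos t.exp ?_)
    rwa [Pi.sub_apply, Finsupp.sub_apply, monomial_apply_self, sub_ne_zero]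
  refine ⟨fun h0 => hc (by rw [← ht, h0]; rfl), ?_⟩
  rw [leadMonomial_eq (leadTerm_eq (ht ▸ hc) fun k s hks => ?_), ht]
  by_contra! hlt
  have h0 : monomial c t k s = 0 :=
    not_not.1 fun h1 => hlt.ne' (eq_of_monomial_apply_ne_zero h1)
  refine (h k s ?_).not_gt hlt
  rwa [Pi.sub_apply, Finsupp.sub_apply, h0, sub_zero]

end Leading

/-! ### The two actions compared, degrees and homogeneous parts. -/

namespace OreData

variable {n m u : ℕ} {R : Type*} [Ring R] (D : OreData n R)

theorem syzAct_graded_component_ne_zero {l r : Expo n} {a b : R} {s : D.Syz u} {e : Fin u}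
    {q : Expo n × Expo n} (h : D.component (D.syzAct D.graded D.hat_le_hat_graded
      (Finsupp.single l a) (Finsupp.single r b) s e) q ≠ 0) :
    ∃ p, D.component (s e) p ≠ 0 ∧ q = (l + p.1, p.2 + r) := by
  obtain ⟨ell, p, a', b', hp, h⟩ := D.exists_of_map_ne_zero (s := s)
    ((Finsupp.applyAddHom q).comp (D.component.toAddMonoidHom.comp ((Pi.evalAddMonoidHom _ e).comp
      (D.syzAct D.graded D.hat_le_hat_graded (Finsupp.single l a)
        (Finsupp.single r b)).toAddMonoidHom))) h
  replace h : D.component (D.syzAct D.graded D.hat_le_hat_graded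
      (Finsupp.single l a) (Finsupp.single r b) (D.elementary ell p a' b') e) q ≠ 0 := h
  rw [syzAct_elementary] at h
  by_cases he : e = ell
  · subst he
    refine ⟨p, hp, ?_⟩
    rw [Pi.single_eq_same, component_tmul] at h
    obtain ⟨x, y, hx, hy, hq₁⟩ := D.graded_mul_apply_ne_zero (f := Finsupp.single l a)
      (h := Finsupp.single p.1 a') (s := q.1) fun h0 => h (by rw [h0, TensorProduct.zero_tmul])
    obtain ⟨x', y', hx', hy', hq₂⟩ := D.graded_mul_apply_ne_zero (f := Finsupp.single p.2 b')
      (h := Finsupp.single r b) (s := q.2) fun h0 => h (by rw [h0, TensorProduct.tmul_zero])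
    rw [Finsupp.single_apply_ne_zero] at hx hy hx' hy'
    rw [hx.1, hy.1] at hq₁
    rw [hx'.1, hy'.1] at hq₂
    exact Prod.ext hq₁ hq₂
  · exact absurd (by rw [Pi.single_eq_of_ne he, map_zero]; rfl) h

/-- If the tensors of coefficients differ, one factor comes from a derivation and drops strictly,
while the other does not exceed its graded exponent. -/
theorem syzAct_component_ne_graded {l r : Expo n} {a b : R} {s : D.Syz u} {e : Fin u}
    {q : Expo n × Expo n} (h : D.component (D.syzAct D le_rfl (Finsupp.single l a)
      (Finsupp.single r b) s e) q ≠ D.component (D.syzAct D.graded D.hat_le_hat_graded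
      (Finsupp.single l a) (Finsupp.single r b) s e) q) :
    ∃ p, D.component (s e) p ≠ 0 ∧ q.1 + q.2 < l + p.1 + (p.2 + r) := by
  obtain ⟨ell, p, a', b', hp, h⟩ := D.exists_of_map_ne
    ((Finsupp.applyAddHom q).comp (D.component.toAddMonoidHom.comp ((Pi.evalAddMonoidHom _ e).comp
      (D.syzAct D le_rfl (Finsupp.single l a) (Finsupp.single r b)).toAddMonoidHom)))
    ((Finsupp.applyAddHom q).comp (D.component.toAddMonoidHom.comp ((Pi.evalAddMonoidHom _ e).comp
      (D.syzAct D.graded D.hat_le_hat_graded (Finsupp.single l a)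
        (Finsupp.single r b)).toAddMonoidHom))) h
  replace h : D.component (D.syzAct D le_rfl (Finsupp.single l a)
      (Finsupp.single r b) (D.elementary ell p a' b') e) q ≠
      D.component (D.syzAct D.graded D.hat_le_hat_graded
      (Finsupp.single l a) (Finsupp.single r b) (D.elementary ell p a' b') e) q := h
  rw [syzAct_elementary, syzAct_elementary] at h
  by_cases he : e = ell
  · subst he
    refine ⟨p, hp, ?_⟩
    rw [Pi.single_eq_same, Pi.single_eq_same, component_tmul, component_tmul] at h
    by_cases h1 : D.mul (Finsupp.single l a) (Finsupp.single p.1 a') q.1 =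
        D.graded.mul (Finsupp.single l a) (Finsupp.single p.1 a') q.1
    · rw [h1] at h
      obtain ⟨x, y, hx, hy, hq₁⟩ := D.graded_mul_apply_ne_zero (f := Finsupp.single l a)
        (h := Finsupp.single p.1 a') (s := q.1)
        fun h0 => h (by rw [h0, TensorProduct.zero_tmul, TensorProduct.zero_tmul])
      obtain ⟨x', y', hx', hy', hq₂⟩ := D.mul_sub_graded_mul_apply_ne_zero
        (f := Finsupp.single p.2 b') (h := Finsupp.single r b) (s := q.2)
        fun h0 => h (by rw [Finsupp.sub_apply, sub_eq_zero] at h0; rw [h0])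
      rw [Finsupp.single_apply_ne_zero] at hx hy hx' hy'
      rw [hx.1, hy.1] at hq₁
      rw [hx'.1, hy'.1] at hq₂
      rw [hq₁]
      exact add_lt_add_right hq₂ _
    · obtain ⟨x, y, hx, hy, hq₁⟩ := D.mul_sub_graded_mul_apply_ne_zero
        (by rwa [Finsupp.sub_apply, sub_ne_zero])
      have hq₂ : ∃ x' y', Finsupp.single p.2 b' x' ≠ 0 ∧ Finsupp.single r b y' ≠ 0 ∧
          q.2 ≤ x' + y' := by
        -- When the Ore coefficient on the right vanishes, the graded one cannot, since the tensors
        -- would otherwise both be zero.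
        by_cases h2 : D.mul (Finsupp.single p.2 b') (Finsupp.single r b) q.2 = 0
        · rw [h2, TensorProduct.tmul_zero] at h
          obtain ⟨x', y', hx', hy', hq₂⟩ := D.graded_mul_apply_ne_zero
            (f := Finsupp.single p.2 b') (h := Finsupp.single r b) (s := q.2)
            fun h0 => h (by rw [h0, TensorProduct.tmul_zero])
          exact ⟨x', y', hx', hy', hq₂.le⟩
        · exact D.mul_apply_ne_zero h2
      obtain ⟨x', y', hx', hy', hq₂⟩ := hq₂
      rw [Finsupp.single_apply_ne_zero] at hx hy hx' hy'
      rw [hx.1, hy.1] at hq₁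
      rw [hx'.1, hy'.1] at hq₂
      exact add_lt_add_of_lt_of_le hq₁ hq₂
  · rw [Pi.single_eq_of_ne he, Pi.single_eq_of_ne he] at h
    exact absurd rfl h

variable [LinearOrder (Term n m)]

theorem degree_add (g : Fin u → FreeMod n m R) (ell : Fin u) (p : Expo n × Expo n)
    (l r : Expo n) :
    degree g ell (l + p.1, p.2 + r) = (degree g ell p).map (Term.shift l r) := by
  rw [degree, degree]
  cases leadTerm (g ell) with
  | bot => rfl
  | coe t =>
    refine congrArg (WithBot.some : Term n m → _) (Term.ext rfl ?_)
    simp only [Term.shift]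
    abel

theorem val_le_iff {g : Fin u → FreeMod n m R} {s : D.Syz u} {d : WithBot (Term n m)} :
    D.val g s ≤ d ↔ ∀ ell p, D.component (s ell) p ≠ 0 → degree g ell p ≤ d := by
  simp [val, Finset.sup_le_iff]

/-- For `d = ⊥` this fails at `s = 0`, where the right side is vacuous; hence `DegreeLT` is stated
by components. -/
theorem val_lt_iff {g : Fin u → FreeMod n m R} {s : D.Syz u} {d : WithBot (Term n m)}
    (hd : ⊥ < d) :
    D.val g s < d ↔ ∀ ell p, D.component (s ell) p ≠ 0 → degree g ell p < d := by
  simp [val, Finset.sup_lt_iff hd]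

theorem degree_le_val {g : Fin u → FreeMod n m R} {s : D.Syz u} {ell : Fin u}
    {p : Expo n × Expo n} (h : D.component (s ell) p ≠ 0) : degree g ell p ≤ D.val g s :=
  D.val_le_iff.1 le_rfl ell p h

/-- All nonzero components of `s` have degree less than `d`. -/
def DegreeLT (g : Fin u → FreeMod n m R) (d : WithBot (Term n m)) (s : D.Syz u) : Prop :=
  ∀ ell p, D.component (s ell) p ≠ 0 → degree g ell p < d

theorem component_add (s t : D.Syz u) (ell : Fin u) (p : Expo n × Expo n) :
    D.component ((s + t) ell) p = D.component (s ell) p + D.component (t ell) p := by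
  rw [Pi.add_apply, map_add, Finsupp.add_apply]

theorem component_sub (s t : D.Syz u) (ell : Fin u) (p : Expo n × Expo n) :
    D.component ((s - t) ell) p = D.component (s ell) p - D.component (t ell) p := by
  rw [Pi.sub_apply, map_sub, Finsupp.sub_apply]

theorem component_zero (ell : Fin u) (p : Expo n × Expo n) :
    D.component ((0 : D.Syz u) ell) p = 0 := by
  rw [Pi.zero_apply, map_zero, Finsupp.zero_apply]

variable {D} in
theorem DegreeLT.add {g : Fin u → FreeMod n m R} {d : WithBot (Term n m)} {s t : D.Syz u}
    (hs : D.DegreeLT g d s) (ht : D.DegreeLT g d t) : D.DegreeLT g d (s + t) := by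
  intro ell p h
  by_cases h1 : D.component (s ell) p = 0
  · exact ht ell p (by rwa [component_add, h1, zero_add] at h)
  · exact hs ell p h1

variable {D} in
theorem DegreeLT.sub {g : Fin u → FreeMod n m R} {d : WithBot (Term n m)} {s t : D.Syz u}
    (hs : D.DegreeLT g d s) (ht : D.DegreeLT g d t) : D.DegreeLT g d (s - t) := by
  intro ell p h
  by_cases h1 : D.component (s ell) p = 0
  · exact ht ell p fun h2 => h (by rw [component_sub, h1, h2, sub_zero])
  · exact hs ell p h1

theorem degreeLT_zero (g : Fin u → FreeMod n m R) (d : WithBot (Term n m)) :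
    D.DegreeLT g d (0 : D.Syz u) :=
  fun ell p h => absurd (D.component_zero ell p) h

open Classical in
/-- The homogeneous part of degree `d`. -/
noncomputable def homPart (g : Fin u → FreeMod n m R) (d : WithBot (Term n m)) (s : D.Syz u) :
    D.Syz u :=
  fun ell => D.component.symm ((D.component (s ell)).filter fun p => degree g ell p = d)

theorem leadForm_eq (g : Fin u → FreeMod n m R) (s : D.Syz u) :
    D.leadForm g s = D.homPart g (D.val g s) s := rfl

open Classical in
theorem component_homPart (g : Fin u → FreeMod n m R) (d : WithBot (Term n m)) (s : D.Syz u)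
    (ell : Fin u) (p : Expo n × Expo n) : D.component (D.homPart g d s ell) p =
      if degree g ell p = d then D.component (s ell) p else 0 := by
  rw [homPart, LinearEquiv.apply_symm_apply, Finsupp.filter_apply]

theorem component_homPart_ne_zero {g : Fin u → FreeMod n m R} {d : WithBot (Term n m)}
    {s : D.Syz u} {ell : Fin u} {p : Expo n × Expo n}
    (h : D.component (D.homPart g d s ell) p ≠ 0) :
    degree g ell p = d ∧ D.component (s ell) p ≠ 0 := by
  rw [component_homPart] at h
  split_ifs at h with h1
  · exact ⟨h1, h⟩
  · exact absurd rfl h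

theorem component_sub_homPart_ne_zero {g : Fin u → FreeMod n m R} {d : WithBot (Term n m)}
    {s : D.Syz u} {ell : Fin u} {p : Expo n × Expo n}
    (h : D.component ((s - D.homPart g d s) ell) p ≠ 0) :
    degree g ell p ≠ d ∧ D.component (s ell) p ≠ 0 := by
  rw [component_sub, component_homPart] at h
  split_ifs at h with h1
  · exact absurd (sub_self _) h
  · exact ⟨h1, by rwa [sub_zero] at h⟩

theorem homPart_add (g : Fin u → FreeMod n m R) (d : WithBot (Term n m)) (s t : D.Syz u) :
    D.homPart g d (s + t) = D.homPart g d s + D.homPart g d t := by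
  refine D.syz_ext fun ell p => ?_
  simp only [component_add, component_homPart]
  split_ifs <;> simp

theorem homPart_sub (g : Fin u → FreeMod n m R) (d : WithBot (Term n m)) (s t : D.Syz u) :
    D.homPart g d (s - t) = D.homPart g d s - D.homPart g d t := by
  refine D.syz_ext fun ell p => ?_
  simp only [component_sub, component_homPart]
  split_ifs <;> simp

theorem homPart_eq_self {g : Fin u → FreeMod n m R} {d : WithBot (Term n m)} {s : D.Syz u}
    (h : ∀ ell p, D.component (s ell) p ≠ 0 → degree g ell p = d) : D.homPart g d s = s := by
  refine D.syz_ext fun ell p => ?_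
  rw [component_homPart]
  split_ifs with h1
  · rfl
  · exact (not_not.1 fun h2 => h1 (h ell p h2)).symm

theorem homPart_eq_zero {g : Fin u → FreeMod n m R} {d : WithBot (Term n m)} {s : D.Syz u}
    (h : ∀ ell p, D.component (s ell) p ≠ 0 → degree g ell p ≠ d) : D.homPart g d s = 0 := by
  refine D.syz_ext fun ell p => ?_
  rw [component_homPart, component_zero]
  split_ifs with h1
  · exact not_not.1 fun h2 => h ell p h2 h1
  · rfl

theorem exists_component_ne_zero {s : D.Syz u} (hs : s ≠ 0) :
    ∃ ell p, D.component (s ell) p ≠ 0 := by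
  by_contra! H
  exact hs (D.syz_ext fun ell p => by rw [H, component_zero])

theorem val_eq_of_homogeneous {g : Fin u → FreeMod n m R} {d : WithBot (Term n m)}
    {s : D.Syz u} (h : ∀ ell p, D.component (s ell) p ≠ 0 → degree g ell p = d) (hs : s ≠ 0) :
    D.val g s = d := by
  obtain ⟨ell, p, hp⟩ := D.exists_component_ne_zero hs
  exact le_antisymm (D.val_le_iff.2 fun ell p h' => (h ell p h').le)
    (h ell p hp ▸ D.degree_le_val hp)

/-! ### Liftings and quasi-Gröbner representations modulo lower degree. -/

/-- `s` agrees with a syzygy up to components of degree less than `d`. -/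
def LiftsBelow (g : Fin u → FreeMod n m R) (d : WithBot (Term n m)) (s : D.Syz u) : Prop :=
  ∃ U : D.Syz u, D.bigS g U = 0 ∧ D.DegreeLT g d (U - s)

theorem liftsBelow_zero (g : Fin u → FreeMod n m R) (d : WithBot (Term n m)) :
    D.LiftsBelow g d (0 : D.Syz u) :=
  ⟨0, map_zero _, (D.degreeLT_zero g d).sub (D.degreeLT_zero g d)⟩

/-- Leading forms are not additive, since top parts may cancel. For homogeneous `s`, fixing the
degree `d` in advance yields an equivalent condition that is. -/
theorem hasLifting_iff {g : Fin u → FreeMod n m R} {d : WithBot (Term n m)} {s : D.Syz u}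
    (h : ∀ ell p, D.component (s ell) p ≠ 0 → degree g ell p = d) :
    D.HasLifting g s ↔ D.LiftsBelow g d s := by
  rcases eq_or_ne s 0 with rfl | hs
  · refine ⟨fun _ => D.liftsBelow_zero g d, fun _ => ⟨0, map_zero _, ?_⟩⟩
    exact D.homPart_eq_zero fun ell p hp => absurd (D.component_zero ell p) hp
  obtain ⟨e, q, hq⟩ := D.exists_component_ne_zero hs
  refine exists_congr fun U => and_congr_right fun _ => ?_
  rw [leadForm_eq]
  constructor
  · rintro rfl
    -- A nonzero component of the leading form has degree both `d` and `v(U)`.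
    have hd : D.val g U = d := by rw [← h e q hq, (D.component_homPart_ne_zero hq).1]
    intro ell p hp
    have := D.component_sub_homPart_ne_zero hp
    exact hd ▸ lt_of_le_of_ne (D.degree_le_val this.2) this.1
  · intro H
    have heq : ∀ ell p, degree g ell p = d →
        D.component (U ell) p = D.component (s ell) p := fun ell p hp => by
      by_contra h0
      exact (H ell p (by rwa [component_sub, sub_ne_zero])).ne hp
    have hv : D.val g U = d := by
      refine le_antisymm (D.val_le_iff.2 fun ell p hp => ?_) ?_
      · by_cases h0 : D.component (s ell) p = 0
        · exact (H ell p (by rwa [component_sub, h0, sub_zero])).le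
        · exact (h ell p h0).le
      · rw [← h e q hq]
        exact D.degree_le_val (by rwa [heq e q (h e q hq)])
    refine D.syz_ext fun ell p => ?_
    rw [component_homPart, hv]
    split_ifs with h1
    · exact heq ell p h1
    · exact (not_not.1 fun h2 => h1 (h ell p h2)).symm

omit [LinearOrder (Term n m)] in
theorem bigS_sub (g : Fin u → FreeMod n m R) (s t : D.Syz u) :
    D.bigS g (s - t) = D.bigS g s - D.bigS g t := map_sub (D.bigS g) s t

omit [LinearOrder (Term n m)] in
theorem bigS_sum_elementary (g : Fin u → FreeMod n m R) {k : ℕ} (a b : Fin k → R)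
    (lam rho : Fin k → Expo n) (ell : Fin k → Fin u) :
    D.bigS g (∑ i, D.elementary (ell i) (lam i, rho i) (a i) (b i)) =
      ∑ i, D.sandwich (Finsupp.single (lam i) (a i)) (g (ell i)) (Finsupp.single (rho i) (b i)) := by
  rw [map_sum]
  exact Finset.sum_congr rfl fun i _ => D.syzEval_elementary D le_rfl g _ _ _ _

theorem hasQuasiGroebnerRep_iff {g : Fin u → FreeMod n m R} {s : D.Syz u} :
    D.HasQuasiGroebnerRep g s ↔ ∃ t, D.DegreeLT g (D.val g s) t ∧ D.bigS g t = D.bigS g s := by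
  constructor
  · rintro ⟨k, a, b, lam, rho, ell, h, hsum⟩
    refine ⟨_, fun e p hp => ?_, (D.bigS_sum_elementary g a b lam rho ell).trans hsum.symm⟩
    obtain ⟨i, rfl, rfl⟩ := D.exists_of_component_sum_ne_zero hp
    exact (h i).2.2
  · rintro ⟨t, ht, hts⟩
    obtain ⟨k, a, b, lam, rho, ell, h, rfl⟩ := D.exists_sum_elementary ht
    exact ⟨k, a, b, lam, rho, ell, h, by rw [← hts, bigS_sum_elementary]⟩

/-- The involution `x ↦ s - x` exchanges lower-degree preimages of 𝔖₂(s) with syzygies agreeing with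
`s` up to lower degree. -/
theorem hasQuasiGroebnerRep_iff_liftsBelow {g : Fin u → FreeMod n m R}
    {d : WithBot (Term n m)} {s : D.Syz u}
    (h : ∀ ell p, D.component (s ell) p ≠ 0 → degree g ell p = d) :
    D.HasQuasiGroebnerRep g s ↔ D.LiftsBelow g d s := by
  rw [hasQuasiGroebnerRep_iff]
  rcases eq_or_ne s 0 with rfl | hs
  · exact ⟨fun _ => D.liftsBelow_zero g d, fun _ => ⟨0, D.degreeLT_zero g _, rfl⟩⟩
  rw [D.val_eq_of_homogeneous h hs]
  constructor
  · rintro ⟨t, ht, hts⟩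
    refine ⟨s - t, by rw [bigS_sub, hts, sub_self], fun ell p hp => ht ell p fun h0 => hp ?_⟩
    rw [component_sub, component_sub, h0, sub_zero, sub_self]
  · rintro ⟨U, hU, hd⟩
    refine ⟨s - U, fun ell p hp => hd ell p fun h0 => hp ?_, by rw [bigS_sub, hU, sub_zero]⟩
    rw [component_sub, sub_eq_zero] at h0 ⊢
    exact h0.symm

/-! ### Degree bounds for 𝔖₂, 𝔰₂ and their difference. -/

section Ordering

variable {ord : MonomialOrder (Fin n)} (hord : IsTermOrdering m ord)
include hord

theorem degree_lt_of_lt {g : Fin u → FreeMod n m R} (hg : ∀ i, g i ≠ 0) {ell : Fin u}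
    {p q : Expo n × Expo n} (h : q.1 + q.2 < p.1 + p.2) : degree g ell q < degree g ell p := by
  obtain ⟨t, ht, -⟩ := exists_leadTerm (hg ell)
  rw [degree, degree, ht]
  refine WithBot.coe_lt_coe.2 ?_
  simp only [Term.shift, add_right_comm _ t.exp]
  exact hord.lt_of_exp_lt _ (add_lt_add_left h _)

theorem coe_le_degree {g : Fin u → FreeMod n m R} {ell : Fin u} {p : Expo n × Expo n}
    {k : Fin m} {b : Expo n} (h : g ell k b ≠ 0) :
    ((Term.shift p.1 p.2 ⟨k, b⟩ : Term n m) : WithBot (Term n m)) ≤ degree g ell p := by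
  have h' := le_leadTerm h
  rw [degree]
  cases ht : leadTerm (g ell) with
  | bot => rw [ht] at h'; exact absurd h' (by simp)
  | coe t =>
    rw [ht] at h'
    exact WithBot.coe_le_coe.2
      ((hord.shift_strictMono p.1 p.2).monotone (WithBot.coe_le_coe.1 h'))

theorem bigS_apply_ne_zero {g : Fin u → FreeMod n m R} {s : D.Syz u} {k : Fin m} {e : Expo n}
    (h : D.bigS g s k e ≠ 0) : ∃ ell p, D.component (s ell) p ≠ 0 ∧
      ((⟨k, e⟩ : Term n m) : WithBot (Term n m)) ≤ degree g ell p := by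
  obtain ⟨ell, p, a, b, hp, h⟩ := D.exists_of_map_ne_zero
    ((Finsupp.applyAddHom e).comp ((Pi.evalAddMonoidHom _ k).comp (D.bigS g).toAddMonoidHom)) h
  replace h : D.bigS g (D.elementary ell p a b) k e ≠ 0 := h
  rw [bigS, syzEval_elementary] at h
  obtain ⟨x, y, z, hx, hy, hz, he⟩ := D.sandwich_apply_ne_zero h
  rw [Finsupp.single_apply_ne_zero] at hx hz
  rw [hx.1, hz.1] at he
  exact ⟨ell, p, hp, (WithBot.coe_le_coe.2 (hord.le_of_exp_le k he)).trans
    (coe_le_degree hord hy)⟩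

omit hord in
theorem smallS_apply_ne_zero {g : Fin u → FreeMod n m R} (hg : ∀ i, g i ≠ 0) {s : D.Syz u}
    {k : Fin m} {e : Expo n} (h : D.smallS g s k e ≠ 0) :
    ∃ ell p, D.component (s ell) p ≠ 0 ∧
      ((⟨k, e⟩ : Term n m) : WithBot (Term n m)) = degree g ell p := by
  obtain ⟨ell, p, a, b, hp, h⟩ := D.exists_of_map_ne_zero
    ((Finsupp.applyAddHom e).comp ((Pi.evalAddMonoidHom _ k).comp (D.smallS g).toAddMonoidHom)) h
  replace h : D.smallS g (D.elementary ell p a b) k e ≠ 0 := h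
  rw [smallS, syzEval_elementary] at h
  obtain ⟨x, y, z, hx, hy, hz, rfl⟩ := D.graded_sandwich_apply_ne_zero h
  rw [Finsupp.single_apply_ne_zero] at hx hz
  obtain ⟨t, ht, -⟩ := exists_leadTerm (hg ell)
  rw [leadMonomial_eq ht] at hy
  refine ⟨ell, p, hp, ?_⟩
  rw [degree, ht, hx.1, hz.1, ← eq_of_monomial_apply_ne_zero hy]
  rfl

/-- There are two sources of discrepancy, both strictly lower: the derivations, which change the
product, and the tail of `g ell` beyond its leading monomial. -/
theorem bigS_sub_smallS_apply_ne_zero {g : Fin u → FreeMod n m R} (hg : ∀ i, g i ≠ 0)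
    {s : D.Syz u} {k : Fin m} {e : Expo n} (h : (D.bigS g s - D.smallS g s) k e ≠ 0) :
    ∃ ell p, D.component (s ell) p ≠ 0 ∧
      ((⟨k, e⟩ : Term n m) : WithBot (Term n m)) < degree g ell p := by
  obtain ⟨ell, p, a, b, hp, h⟩ := D.exists_of_map_ne_zero
    ((Finsupp.applyAddHom e).comp ((Pi.evalAddMonoidHom _ k).comp
      (D.bigS g - D.smallS g).toAddMonoidHom)) h
  replace h : (D.bigS g (D.elementary ell p a b) - D.smallS g (D.elementary ell p a b)) k e ≠ 0 :=
    h
  rw [bigS, smallS, syzEval_elementary, syzEval_elementary] at h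
  refine ⟨ell, p, hp, ?_⟩
  obtain ⟨t, ht, -⟩ := exists_leadTerm (hg ell)
  by_cases h1 : (D.sandwich (Finsupp.single p.1 a) (g ell) (Finsupp.single p.2 b) k -
      D.graded.sandwich (Finsupp.single p.1 a) (g ell) (Finsupp.single p.2 b) k) e = 0
  -- With no contribution from the derivations, the discrepancy is the graded product with the tail.
  · have hadd := D.graded.sandwich_add (Finsupp.single p.1 a) (Finsupp.single p.2 b)
      (g ell - leadMonomial (g ell)) (leadMonomial (g ell))
    rw [sub_add_cancel] at hadd
    rw [hadd, Pi.add_apply, ← sub_sub, sub_right_comm, Finsupp.sub_apply, sub_eq_zero] at h1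
    rw [Pi.sub_apply, h1] at h
    obtain ⟨x, y, z, hx, hy, hz, rfl⟩ := D.graded_sandwich_apply_ne_zero h
    rw [Finsupp.single_apply_ne_zero] at hx hz
    have hlt := sub_leadMonomial_apply_ne_zero hy
    rw [ht] at hlt
    rw [degree, ht, hx.1, hz.1]
    exact WithBot.coe_lt_coe.2 (hord.shift_strictMono p.1 p.2 (WithBot.coe_lt_coe.1 hlt))
  · obtain ⟨x, y, z, hx, hy, hz, he⟩ := D.sandwich_sub_graded_apply_ne_zero h1
    rw [Finsupp.single_apply_ne_zero] at hx hz
    rw [hx.1, hz.1] at he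
    exact (WithBot.coe_lt_coe.2 (hord.lt_of_exp_lt k he)).trans_le (coe_le_degree hord hy)

/-- The graded coefficient at the top is nonzero by injectivity of the αᵢ, and corrections lie
strictly below, so it survives. -/
theorem leadTerm_sandwich {g : Fin u → FreeMod n m R} (hg : ∀ i, g i ≠ 0) (ell : Fin u)
    (l r : Expo n) : leadTerm (D.sandwich (Finsupp.single l 1) (g ell) (Finsupp.single r 1)) =
      degree g ell (l, r) := by
  have hS : D.bigS g (D.elementary ell (l, r) 1 1) =
      D.sandwich (Finsupp.single l 1) (g ell) (Finsupp.single r 1) :=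
    D.syzEval_elementary D le_rfl g ell (l, r) 1 1
  have hs : D.smallS g (D.elementary ell (l, r) 1 1) = D.graded.sandwich (Finsupp.single l 1)
      (leadMonomial (g ell)) (Finsupp.single r 1) :=
    D.syzEval_elementary D.graded D.hat_le_hat_graded _ ell (l, r) 1 1
  obtain ⟨t, ht, hc⟩ := exists_leadTerm (hg ell)
  have hd : degree g ell (l, r) = (t.shift l r : Term n m) := by rw [degree, ht]; rfl
  rw [hd, ← hS]
  refine leadTerm_eq ?_ fun k e h => ?_
  · have hne := D.graded_sandwich_monomial_apply_ne_zero l r hc t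
    rw [← leadMonomial_eq ht, ← hs] at hne
    intro h0
    obtain ⟨e, q, hq, hlt⟩ := D.bigS_sub_smallS_apply_ne_zero hord hg
      (s := D.elementary ell (l, r) 1 1) (k := t.pos) (e := l + t.exp + r) (by
        rw [Pi.sub_apply, Finsupp.sub_apply, show D.bigS g (D.elementary ell (l, r) 1 1) t.pos
          (l + t.exp + r) = 0 from h0, zero_sub]
        exact neg_ne_zero.2 hne)
    obtain ⟨rfl, rfl⟩ := D.component_elementary hq
    rw [hd] at hlt
    exact lt_irrefl _ hlt
  · obtain ⟨e, q, hq, hle⟩ := D.bigS_apply_ne_zero hord h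
    obtain ⟨rfl, rfl⟩ := D.component_elementary hq
    rw [hd] at hle
    exact WithBot.coe_le_coe.1 hle

theorem hasGroebnerRep_iff {g : Fin u → FreeMod n m R} (hg : ∀ i, g i ≠ 0)
    {f : FreeMod n m R} :
    D.HasGroebnerRep g f ↔ ∃ t, D.val g t ≤ leadTerm f ∧ D.bigS g t = f := by
  simp only [HasGroebnerRep, D.leadTerm_sandwich hord hg]
  constructor
  · rintro ⟨k, a, b, lam, rho, ell, h, hsum⟩
    refine ⟨_, D.val_le_iff.2 fun e p hp => ?_,
      (D.bigS_sum_elementary g a b lam rho ell).trans hsum.symm⟩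
    obtain ⟨i, rfl, rfl⟩ := D.exists_of_component_sum_ne_zero hp
    exact (h i).2.2
  · rintro ⟨t, ht, hts⟩
    obtain ⟨k, a, b, lam, rho, ell, h, rfl⟩ := D.exists_sum_elementary (D.val_le_iff.1 ht)
    exact ⟨k, a, b, lam, rho, ell, h, by rw [← hts, bigS_sum_elementary]⟩

end Ordering

end OreData

/-! ### Homogeneity of 𝔰₂ and of the graded bimodule. -/

namespace OreData

variable {n m u : ℕ} {R : Type*} [Ring R] (D : OreData n R) [LinearOrder (Term n m)]

variable {D} in
theorem LiftsBelow.add {g : Fin u → FreeMod n m R} {d : WithBot (Term n m)} {s t : D.Syz u}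
    (hs : D.LiftsBelow g d s) (ht : D.LiftsBelow g d t) : D.LiftsBelow g d (s + t) := by
  obtain ⟨U, hU, hs⟩ := hs
  obtain ⟨V, hV, ht⟩ := ht
  refine ⟨U + V, by rw [map_add, hU, hV, add_zero], fun ell p hp => hs.add ht ell p ?_⟩
  rw [component_sub, component_add, component_add] at hp
  rwa [component_add, component_sub, component_sub, ← add_sub_add_comm]

variable {D} in
theorem LiftsBelow.sub {g : Fin u → FreeMod n m R} {d : WithBot (Term n m)} {s t : D.Syz u}
    (hs : D.LiftsBelow g d s) (ht : D.LiftsBelow g d t) : D.LiftsBelow g d (s - t) := by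
  obtain ⟨U, hU, hs⟩ := hs
  obtain ⟨V, hV, ht⟩ := ht
  refine ⟨U - V, by rw [bigS_sub, hU, hV, sub_zero], fun ell p hp => hs.sub ht ell p ?_⟩
  rw [component_sub, component_sub, component_sub] at hp
  rwa [component_sub, component_sub, component_sub, sub_sub_sub_comm]

omit [LinearOrder (Term n m)] in
theorem mem_bimodule_iff {g : Fin u → FreeMod n m R} {f : FreeMod n m R} :
    f ∈ D.bimodule (Set.range g) ↔ ∃ s, D.bigS g s = f :=
  D.mem_range_syzEval D le_rfl g f

theorem leadMonomials_range {g : Fin u → FreeMod n m R} (hg : ∀ i, g i ≠ 0) :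
    leadMonomials (Set.range g) = Set.range fun ell => leadMonomial (g ell) := by
  ext x
  constructor
  · rintro ⟨_, ⟨ell, rfl⟩, -, rfl⟩
    exact ⟨ell, rfl⟩
  · rintro ⟨ell, rfl⟩
    exact ⟨g ell, ⟨ell, rfl⟩, hg ell, rfl⟩

theorem mem_graded_bimodule_iff {g : Fin u → FreeMod n m R} (hg : ∀ i, g i ≠ 0)
    {f : FreeMod n m R} :
    f ∈ D.graded.bimodule (leadMonomials (Set.range g)) ↔ ∃ s, D.smallS g s = f := by
  rw [leadMonomials_range hg]
  exact D.mem_range_syzEval D.graded D.hat_le_hat_graded _ f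

theorem smallS_homPart_apply_of_ne {g : Fin u → FreeMod n m R} (hg : ∀ i, g i ≠ 0)
    (s : D.Syz u) {d : WithBot (Term n m)} {k : Fin m} {e : Expo n}
    (h : ((⟨k, e⟩ : Term n m) : WithBot (Term n m)) ≠ d) :
    D.smallS g (D.homPart g d s) k e = 0 := by
  by_contra h0
  obtain ⟨ell, p, hp, heq⟩ := D.smallS_apply_ne_zero hg h0
  exact h (heq.trans (D.component_homPart_ne_zero hp).1)

theorem smallS_homPart_apply {g : Fin u → FreeMod n m R} (hg : ∀ i, g i ≠ 0)
    (s : D.Syz u) {d : WithBot (Term n m)} {k : Fin m} {e : Expo n}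
    (h : ((⟨k, e⟩ : Term n m) : WithBot (Term n m)) = d) :
    D.smallS g (D.homPart g d s) k e = D.smallS g s k e := by
  by_contra h0
  have hsub : D.smallS g (s - D.homPart g d s) = D.smallS g s - D.smallS g (D.homPart g d s) :=
    map_sub (D.smallS g) _ _
  obtain ⟨ell, p, hp, heq⟩ := D.smallS_apply_ne_zero hg
    (s := s - D.homPart g d s) (k := k) (e := e) (by
      rw [hsub, Pi.sub_apply, Finsupp.sub_apply, sub_ne_zero]
      exact Ne.symm h0)
  exact (D.component_sub_homPart_ne_zero hp).1 (heq.symm.trans h)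

theorem smallS_homPart {g : Fin u → FreeMod n m R} (hg : ∀ i, g i ≠ 0) (s : D.Syz u)
    (t : Term n m) :
    D.smallS g (D.homPart g t s) = monomial (D.smallS g s t.pos t.exp) t := by
  rw [← D.smallS_homPart_apply hg s (d := t) rfl]
  exact eq_monomial fun k e h => by
    by_contra h0
    exact h (D.smallS_homPart_apply_of_ne hg s fun h1 => h0 (WithBot.coe_inj.1 h1))

/-- The leading monomial of an element of the graded bimodule lies in it. -/
theorem exists_smallS_eq_leadMonomial {g : Fin u → FreeMod n m R} (hg : ∀ i, g i ≠ 0)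
    {s : D.Syz u} {t : Term n m} (ht : leadTerm (D.smallS g s) = t) :
    D.smallS g (D.homPart g t s) = leadMonomial (D.smallS g s) := by
  rw [smallS_homPart D hg, leadMonomial_eq ht]

/-- A bimodule generated by monomials over the graded ring contains the leading monomial of each
nonzero element: it is the image of a homogeneous part of any preimage. -/
theorem leadMonomials_graded_bimodule {g : Fin u → FreeMod n m R} (hg : ∀ i, g i ≠ 0) :
    leadMonomials (D.graded.bimodule (leadMonomials (Set.range g)) : Set (FreeMod n m R)) =
      (D.graded.bimodule (leadMonomials (Set.range g)) : Set (FreeMod n m R)) ∩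
        monomials n m R := by
  ext x
  constructor
  · rintro ⟨f, hf, hf0, rfl⟩
    obtain ⟨s, rfl⟩ := (D.mem_graded_bimodule_iff hg).1 hf
    obtain ⟨t, ht, hc⟩ := exists_leadTerm hf0
    exact ⟨(D.mem_graded_bimodule_iff hg).2 ⟨_, D.exists_smallS_eq_leadMonomial hg ht⟩,
      _, t, hc, leadMonomial_eq ht⟩
  · rintro ⟨hx, c, t, hc, rfl⟩
    refine ⟨_, hx, fun h0 => hc ?_, (leadMonomial_monomial hc t).symm⟩
    rw [← monomial_apply_self c t, h0]
    rfl

theorem val_homPart_le (g : Fin u → FreeMod n m R) (d : WithBot (Term n m)) (s : D.Syz u) :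
    D.val g (D.homPart g d s) ≤ d :=
  D.val_le_iff.2 fun _ _ hp => (D.component_homPart_ne_zero hp).1.le

theorem homPart_homPart (g : Fin u → FreeMod n m R) (d : WithBot (Term n m)) (s : D.Syz u) :
    D.homPart g d (D.homPart g d s) = D.homPart g d s :=
  D.homPart_eq_self fun _ _ hp => (D.component_homPart_ne_zero hp).1

/-! ### Division, leading monomials and the lifting of syzygies. -/

section Ordering

variable {ord : MonomialOrder (Fin n)} (hord : IsTermOrdering m ord)
include hord

theorem bigS_sub_smallS_homPart_apply_ne_zero {g : Fin u → FreeMod n m R} (hg : ∀ i, g i ≠ 0)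
    {s : D.Syz u} {t : Term n m} (hs : D.val g s ≤ t) {k : Fin m} {e : Expo n}
    (h : (D.bigS g s - D.smallS g (D.homPart g t s)) k e ≠ 0) : (⟨k, e⟩ : Term n m) < t := by
  by_contra hlt
  -- At `t`, the homogeneous part computes all of 𝔰₂(s), which agrees there with 𝔖₂(s); above `t`,
  -- both maps vanish.
  rcases (not_lt.1 hlt).eq_or_lt with heq | hgt
  · rw [Pi.sub_apply, Finsupp.sub_apply, D.smallS_homPart_apply hg s (by rw [heq]),
      ← Finsupp.sub_apply, ← Pi.sub_apply] at h
    obtain ⟨ell, p, hp, hd⟩ := D.bigS_sub_smallS_apply_ne_zero hord hg h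
    exact hlt (WithBot.coe_lt_coe.1 (hd.trans_le ((D.degree_le_val hp).trans hs)))
  · rw [Pi.sub_apply, Finsupp.sub_apply, D.smallS_homPart_apply_of_ne hg s
      (fun h0 => hgt.ne' (WithBot.coe_inj.1 h0)), sub_zero] at h
    obtain ⟨ell, p, hp, hd⟩ := D.bigS_apply_ne_zero hord h
    exact hgt.not_ge (WithBot.coe_le_coe.1 (hd.trans ((D.degree_le_val hp).trans hs)))

/-- The division algorithm: cancel the leading monomial by a homogeneous combination and recurse on
the leading term. -/
theorem exists_val_le_of_leadMonomial {g : Fin u → FreeMod n m R} (hg : ∀ i, g i ≠ 0)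
    (h : ∀ f ∈ D.bimodule (Set.range g), f ≠ 0 → ∃ s, D.smallS g s = leadMonomial f)
    (f : FreeMod n m R) (hf : f ∈ D.bimodule (Set.range g)) :
    ∃ s, D.val g s ≤ leadTerm f ∧ D.bigS g s = f := by
  have := hord.wf
  induction hd : leadTerm f using WellFoundedLT.induction generalizing f with
  | ind d ih =>
    subst hd
    rcases eq_or_ne f 0 with rfl | hf0
    · exact ⟨0, D.val_le_iff.2 fun ell p hp => absurd (D.component_zero ell p) hp, map_zero _⟩
    obtain ⟨t, ht, hc⟩ := exists_leadTerm hf0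
    obtain ⟨s, hs⟩ := h f hf hf0
    have hM : D.smallS g (D.homPart g t s) = leadMonomial f := by
      rw [smallS_homPart D hg, hs, leadMonomial_eq ht, monomial_apply_self]
    have hlt : leadTerm (f - D.bigS g (D.homPart g t s)) < leadTerm f := by
      by_cases h0 : f - D.bigS g (D.homPart g t s) = 0
      · rw [h0, ht]
        refine lt_of_le_of_lt (leadTerm_le_iff.2 fun k s h => absurd rfl h) (WithBot.bot_lt_coe t)
      obtain ⟨t', ht', hc'⟩ := exists_leadTerm h0
      rw [ht', ht, WithBot.coe_lt_coe]
      -- With σ the degree-t part, f − 𝔖₂(σ) = (f − 𝐌(f)) − (𝔖₂(σ) − 𝔰₂(σ)), and both differences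
      -- lie below t.
      by_cases h1 : (f - leadMonomial f) t'.pos t'.exp = 0
      · refine D.bigS_sub_smallS_homPart_apply_ne_zero hord hg (D.val_homPart_le g t s)
          (k := t'.pos) (e := t'.exp) fun h2 => hc' ?_
        rw [homPart_homPart, hM] at h2
        rw [← sub_sub_sub_cancel_right _ _ (leadMonomial f), Pi.sub_apply, Finsupp.sub_apply, h1,
          h2, sub_zero]
      · have := sub_leadMonomial_apply_ne_zero h1
        rw [ht] at this
        exact WithBot.coe_lt_coe.1 this
    obtain ⟨s', hs', hs''⟩ := ih _ hlt _
      (sub_mem hf (D.mem_bimodule_iff.2 ⟨D.homPart g t s, rfl⟩)) rfl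
    refine ⟨D.homPart g t s + s', D.val_le_iff.2 fun ell p hp => ?_, ?_⟩
    · by_cases h0 : D.component (s' ell) p = 0
      · rw [component_add, h0, add_zero] at hp
        rw [ht]
        exact (D.component_homPart_ne_zero hp).1.le
      · exact ((D.degree_le_val h0).trans hs').trans hlt.le
    · rw [map_add, hs'', add_sub_cancel]

theorem leadMonomials_bimodule {g : Fin u → FreeMod n m R} (hg : ∀ i, g i ≠ 0)
    (h : ∀ f ∈ D.bimodule (Set.range g), f ≠ 0 → ∃ s, D.val g s ≤ leadTerm f ∧ D.bigS g s = f) :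
    leadMonomials (D.bimodule (Set.range g) : Set (FreeMod n m R)) =
      leadMonomials (D.graded.bimodule (leadMonomials (Set.range g)) : Set (FreeMod n m R)) := by
  have key : ∀ (s : D.Syz u) (t : Term n m), D.val g s ≤ t → D.smallS g s t.pos t.exp ≠ 0 →
      D.bigS g s ≠ 0 ∧ leadMonomial (D.bigS g s) = D.smallS g (D.homPart g t s) := by
    intro s t hs hc
    rw [smallS_homPart D hg]
    refine leadMonomial_eq_of_sub hc fun k e hke => ?_
    rw [← D.smallS_homPart hg] at hke
    exact D.bigS_sub_smallS_homPart_apply_ne_zero hord hg hs hke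
  rw [D.leadMonomials_graded_bimodule hg]
  ext x
  constructor
  · rintro ⟨f, hf, hf0, rfl⟩
    obtain ⟨s, hs, rfl⟩ := h f hf hf0
    obtain ⟨t, ht, hc⟩ := exists_leadTerm hf0
    rw [ht] at hs
    -- Otherwise the nonzero coefficient of 𝔖₂(s) at `t` would belong to the strictly lower
    -- difference.
    have hc' : D.smallS g s t.pos t.exp ≠ 0 := fun h0 =>
      lt_irrefl t (D.bigS_sub_smallS_homPart_apply_ne_zero hord hg hs (k := t.pos) (e := t.exp) (by
        rwa [Pi.sub_apply, Finsupp.sub_apply, D.smallS_homPart_apply hg s rfl, h0, sub_zero]))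
    exact ⟨(D.mem_graded_bimodule_iff hg).2 ⟨_, (key s t hs hc').2.symm⟩, _, t, hc,
      leadMonomial_eq ht⟩
  · rintro ⟨hx, c, t, hc, rfl⟩
    obtain ⟨s, hs⟩ := (D.mem_graded_bimodule_iff hg).1 hx
    have hst : D.smallS g (D.homPart g t s) = monomial c t := by
      rw [smallS_homPart D hg, hs, monomial_apply_self]
    obtain ⟨h0, h1⟩ := key (D.homPart g t s) t (D.val_homPart_le g t s)
      (by rwa [hst, monomial_apply_self])
    exact ⟨_, D.mem_bimodule_iff.2 ⟨_, rfl⟩, h0, by rw [h1, homPart_homPart, hst]⟩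

theorem liftsBelow_of_exists_val_le {g : Fin u → FreeMod n m R} (hg : ∀ i, g i ≠ 0)
    (h : ∀ f ∈ D.bimodule (Set.range g), f ≠ 0 → ∃ s, D.val g s ≤ leadTerm f ∧ D.bigS g s = f)
    {d : WithBot (Term n m)} {s : D.Syz u}
    (hs : ∀ ell p, D.component (s ell) p ≠ 0 → degree g ell p = d) (hs0 : D.smallS g s = 0) :
    D.LiftsBelow g d s := by
  by_cases hS : D.bigS g s = 0
  · exact ⟨s, hS, fun ell p hp => absurd (by rw [component_sub, sub_self]) hp⟩
  obtain ⟨t, ht, hts⟩ := h _ (D.mem_bimodule_iff.2 ⟨s, rfl⟩) hS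
  obtain ⟨τ, hτ, hc⟩ := exists_leadTerm hS
  -- As 𝔰₂(s) = 0, the leading term of 𝔖₂(s) is strictly below `d`, hence so is the valuation of its
  -- representation.
  obtain ⟨ell, p, hp, hlt⟩ := D.bigS_sub_smallS_apply_ne_zero hord hg (s := s) (k := τ.pos)
    (e := τ.exp) (by rwa [hs0, sub_zero])
  rw [hs ell p hp] at hlt
  refine ⟨s - t, by rw [bigS_sub, hts, sub_self], fun ell p hp => ?_⟩
  have hp' : D.component (t ell) p ≠ 0 := fun h0 => hp (by
    rw [component_sub, component_sub, h0, sub_zero, sub_self])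
  exact ((D.degree_le_val hp').trans (ht.trans hτ.le)).trans_lt hlt

/-- Too large a valuation means that the top components cancel in 𝔰₂; subtracting a lifting of them
keeps the image under 𝔖₂ and lowers the valuation. -/
theorem exists_val_le_of_liftsBelow {g : Fin u → FreeMod n m R} (hg : ∀ i, g i ≠ 0)
    (h : ∀ (d : WithBot (Term n m)) (s : D.Syz u),
      (∀ ell p, D.component (s ell) p ≠ 0 → degree g ell p = d) → D.smallS g s = 0 →
      D.LiftsBelow g d s) (s : D.Syz u) :
    ∃ t, D.val g t ≤ leadTerm (D.bigS g s) ∧ D.bigS g t = D.bigS g s := by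
  have := hord.wf
  induction hd : D.val g s using WellFoundedLT.induction generalizing s with
  | ind d ih =>
    subst hd
    rcases le_or_gt (D.val g s) (leadTerm (D.bigS g s)) with hle | hlt
    · exact ⟨s, hle, rfl⟩
    obtain ⟨U, hU, hUs⟩ := h (D.val g s) (D.homPart g (D.val g s) s)
      (fun _ _ hp => (D.component_homPart_ne_zero hp).1) (by
        funext k
        ext e
        by_cases hke : ((⟨k, e⟩ : Term n m) : WithBot (Term n m)) = D.val g s
        · rw [D.smallS_homPart_apply hg s hke]
          by_contra h0
          have hb : D.bigS g s k e = 0 := by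
            by_contra hb
            exact (le_leadTerm hb).not_gt (hke ▸ hlt)
          obtain ⟨ell, p, hp, hd⟩ := D.bigS_sub_smallS_apply_ne_zero hord hg (s := s)
            (k := k) (e := e) (by
              rw [Pi.sub_apply, Finsupp.sub_apply, hb, zero_sub]
              exact neg_ne_zero.2 h0)
          exact (D.degree_le_val hp).not_gt (hke ▸ hd)
        · rw [D.smallS_homPart_apply_of_ne hg s hke]
          rfl)
    obtain ⟨t, ht, hts⟩ := ih (D.val g (s - U)) ((D.val_lt_iff (bot_le.trans_lt hlt)).2
      fun ell p hp => by
        by_cases h0 : D.component ((U - D.homPart g (D.val g s) s) ell) p = 0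
        · rw [component_sub, sub_eq_zero] at h0
          rw [component_sub, h0, ← component_sub] at hp
          have := D.component_sub_homPart_ne_zero hp
          exact lt_of_le_of_ne (D.degree_le_val this.2) this.1
        · exact hUs ell p h0) (s - U) rfl
    rw [bigS_sub, hU, sub_zero] at ht hts
    exact ⟨t, ht, hts⟩

theorem liftsBelow_homPart_syzAct_single {g : Fin u → FreeMod n m R} (hg : ∀ i, g i ≠ 0)
    {d₀ : WithBot (Term n m)} {s : D.Syz u}
    (hs : ∀ ell p, D.component (s ell) p ≠ 0 → degree g ell p = d₀) (hl : D.LiftsBelow g d₀ s)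
    (d : WithBot (Term n m)) (l r : Expo n) (a b : R) :
    D.LiftsBelow g d (D.homPart g d (D.syzAct D.graded D.hat_le_hat_graded
      (Finsupp.single l a) (Finsupp.single r b) s)) := by
  have hmono : StrictMono (WithBot.map (Term.shift l r : Term n m → Term n m)) :=
    (hord.shift_strictMono l r).withBot_map
  have hdeg : ∀ ell p, D.component (D.syzAct D.graded D.hat_le_hat_graded
      (Finsupp.single l a) (Finsupp.single r b) s ell) p ≠ 0 →
      degree g ell p = d₀.map (Term.shift l r) := by
    intro ell q hq
    obtain ⟨p, hp, rfl⟩ := D.syzAct_graded_component_ne_zero hq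
    rw [degree_add, hs ell p hp]
  -- The graded monomial action keeps `s` homogeneous, of this shifted degree; every other
  -- homogeneous part is zero.
  by_cases hd : d = d₀.map (Term.shift l r)
  · subst hd
    rw [D.homPart_eq_self hdeg]
    obtain ⟨U, hU, hUs⟩ := hl
    -- The lifting is moved by the action of 𝖱, which preserves ker 𝔖₂. Its error is the graded
    -- image of `U - s` plus the difference of the two actions on `U`.
    refine ⟨D.syzAct D le_rfl (Finsupp.single l a) (Finsupp.single r b) U, ?_, fun ell q hq => ?_⟩
    · rw [bigS, syzEval_syzAct, ← bigS, hU, sandwich_zero]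
    rw [component_sub, sub_ne_zero] at hq
    by_cases h1 : D.component (D.syzAct D le_rfl (Finsupp.single l a) (Finsupp.single r b) U ell)
        q = D.component (D.syzAct D.graded D.hat_le_hat_graded (Finsupp.single l a)
          (Finsupp.single r b) U ell) q
    · have hsub : D.syzAct D.graded D.hat_le_hat_graded (Finsupp.single l a)
          (Finsupp.single r b) (U - s) = D.syzAct D.graded D.hat_le_hat_graded
          (Finsupp.single l a) (Finsupp.single r b) U - D.syzAct D.graded D.hat_le_hat_graded
          (Finsupp.single l a) (Finsupp.single r b) s := map_sub (D.syzAct D.graded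
            D.hat_le_hat_graded (Finsupp.single l a) (Finsupp.single r b)) U s
      obtain ⟨p, hp, rfl⟩ := D.syzAct_graded_component_ne_zero (l := l) (r := r) (a := a) (b := b)
        (s := U - s) (e := ell) (q := q) (by
          rw [hsub, component_sub, sub_ne_zero, ← h1]
          exact hq)
      rw [degree_add]
      exact hmono (hUs ell p hp)
    · obtain ⟨p, hp, hlt⟩ := D.syzAct_component_ne_graded h1
      have hp₀ : degree g ell p ≤ d₀ := by
        by_cases h0 : D.component (s ell) p = 0
        · exact (hUs ell p (by rwa [component_sub, h0, sub_zero])).le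
        · exact (hs ell p h0).le
      refine (degree_lt_of_lt hord hg (p := (l + p.1, p.2 + r)) hlt).trans_le ?_
      rw [degree_add]
      exact hmono.monotone hp₀
  · rw [D.homPart_eq_zero fun ell p hp h => hd (h.symm.trans (hdeg ell p hp))]
    exact D.liftsBelow_zero g d

theorem liftsBelow_homPart_syzAct {g : Fin u → FreeMod n m R} (hg : ∀ i, g i ≠ 0)
    {d₀ : WithBot (Term n m)} {s : D.Syz u}
    (hs : ∀ ell p, D.component (s ell) p ≠ 0 → degree g ell p = d₀) (hl : D.LiftsBelow g d₀ s)
    (d : WithBot (Term n m)) (l r : OreCarrier n R) :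
    D.LiftsBelow g d (D.homPart g d (D.syzAct D.graded D.hat_le_hat_graded l r s)) := by
  have hr : ∀ l a, D.LiftsBelow g d (D.homPart g d (D.syzAct D.graded D.hat_le_hat_graded
      (Finsupp.single l a) r s)) := fun l a => by
    induction r using Finsupp.induction_linear with
    | zero =>
      -- Zero is the monomial with zero coefficient, so the monomial case applies.
      rw [← Finsupp.single_zero (0 : Expo n)]
      exact D.liftsBelow_homPart_syzAct_single hord hg hs hl d l 0 a 0
    | add r r' h h' => rw [syzAct_add_right, homPart_add]; exact h.add h'
    | single r b => exact D.liftsBelow_homPart_syzAct_single hord hg hs hl d l r a b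
  induction l using Finsupp.induction_linear with
  | zero =>
    rw [← Finsupp.single_zero (0 : Expo n)]
    exact hr 0 0
  | add l l' h h' => rw [syzAct_add_left, homPart_add]; exact h.add h'
  | single l a => exact hr l a

theorem liftsBelow_of_isGebauerMoeller {g : Fin u → FreeMod n m R} (hg : ∀ i, g i ≠ 0)
    {GM : Set (D.Syz u)} (hGM : D.IsGebauerMoeller g GM) (h : ∀ s ∈ GM, D.HasLifting g s)
    {d : WithBot (Term n m)} {s : D.Syz u}
    (hs : ∀ ell p, D.component (s ell) p ≠ 0 → degree g ell p = d) (hs0 : D.smallS g s = 0) :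
    D.LiftsBelow g d s := by
  rw [← D.homPart_eq_self hs]
  have hmem : s ∈ {s | D.smallS g s = 0} := hs0
  rw [← hGM.2] at hmem
  -- Summands in the closure need not be homogeneous of degree `d`; the induction concerns only
  -- their degree-`d` parts, which are additive in the element.
  clear hs hs0
  induction hmem using AddSubgroup.closure_induction with
  | mem x hx =>
    obtain ⟨l, r, t, ht, rfl⟩ := hx
    obtain ⟨d₀, hd₀⟩ := hGM.1 t ht
    exact D.liftsBelow_homPart_syzAct hord hg hd₀ ((D.hasLifting_iff hd₀).1 (h t ht)) d l r
  | zero =>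
    rw [D.homPart_eq_zero fun ell p hp => absurd (D.component_zero ell p) hp]
    exact D.liftsBelow_zero g d
  | add x y _ _ hx hy => rw [homPart_add]; exact hx.add hy
  | neg x _ hx =>
    rw [← zero_sub, homPart_sub, D.homPart_eq_zero (s := 0) fun ell p hp =>
      absurd (D.component_zero ell p) hp]
    exact (D.liftsBelow_zero g d).sub hx

end Ordering

theorem IsGebauerMoeller.smallS_eq_zero {g : Fin u → FreeMod n m R} {GM : Set (D.Syz u)}
    (hGM : D.IsGebauerMoeller g GM) {s : D.Syz u} (hs : s ∈ GM) : D.smallS g s = 0 := by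
  have h : s ∈ {s | D.smallS g s = 0} := by
    rw [← hGM.2]
    exact AddSubgroup.subset_closure ⟨Finsupp.single 0 1, Finsupp.single 0 1, s, hs,
      (D.syzAct_one D.graded D.hat_le_hat_graded s).symm⟩
  exact h

end OreData

/-! ### The equivalences. -/

theorem mainTheorem2 {R : Type*} [Ring R] [IsDomain R] {n m u : ℕ} (D : OreData n R)
    (ord : MonomialOrder (Fin n)) [LinearOrder (Term n m)] (hord : IsTermOrdering m ord)
    (g : Fin u → FreeMod n m R) (hg : ∀ i, g i ≠ 0)
    (GM : Set (D.Syz u)) (hGM : D.IsGebauerMoeller g GM) :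
    List.TFAE [
      D.IsGroebnerBasis (Set.range g) (D.bimodule (Set.range g)),
      ∀ f : FreeMod n m R, f ≠ 0 → (f ∈ D.bimodule (Set.range g) ↔ D.HasGroebnerRep g f),
      ∀ s ∈ GM, D.HasQuasiGroebnerRep g s,
      ∀ s ∈ GM, D.HasLifting g s,
      ∀ s : D.Syz u, D.IsHomogeneous g s → D.smallS g s = 0 → D.HasLifting g s] := by
  -- A representation always forces membership in the module, so only the other direction carries
  -- content.
  have h2 : (∀ f : FreeMod n m R, f ≠ 0 →
      (f ∈ D.bimodule (Set.range g) ↔ D.HasGroebnerRep g f)) ↔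
      ∀ f ∈ D.bimodule (Set.range g), f ≠ 0 →
        ∃ s, D.val g s ≤ leadTerm f ∧ D.bigS g s = f := by
    simp only [D.hasGroebnerRep_iff hord hg]
    refine ⟨fun h f hf hf0 => (h f hf0).1 hf, fun h f hf0 => ⟨fun hf => h f hf hf0, ?_⟩⟩
    rintro ⟨s, -, hs⟩
    exact D.mem_bimodule_iff.2 ⟨s, hs⟩
  rw [h2]
  tfae_have 1 → 2 := by
    rintro ⟨-, h, h'⟩ f hf hf0
    refine D.exists_val_le_of_leadMonomial hord hg (fun f hf hf0 => ?_) f hf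
    have hM : leadMonomial f ∈ leadMonomials (D.bimodule (Set.range g) : Set (FreeMod n m R)) :=
      ⟨f, hf, hf0, rfl⟩
    rw [h, h'] at hM
    exact (D.mem_graded_bimodule_iff hg).1 hM.1
  tfae_have 2 → 1 := fun h => by
    refine ⟨?_, D.leadMonomials_bimodule hord hg h, D.leadMonomials_graded_bimodule hg⟩
    rintro _ ⟨ell, rfl⟩
    refine AddSubgroup.subset_closure ⟨Finsupp.single 0 1, Finsupp.single 0 1, _, ⟨ell, rfl⟩, ?_⟩
    funext k
    rw [OreData.sandwich, D.mul_single_one, D.C_mul, one_smul]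
  tfae_have 2 → 5 := fun h s ⟨_, hd⟩ hs =>
    (D.hasLifting_iff hd).2 (D.liftsBelow_of_exists_val_le hord hg h hd hs)
  tfae_have 5 → 2 := fun h f hf _ => by
    obtain ⟨s, rfl⟩ := D.mem_bimodule_iff.1 hf
    exact D.exists_val_le_of_liftsBelow hord hg
      (fun d s hd hs => (D.hasLifting_iff hd).1 (h s ⟨d, hd⟩ hs)) s
  tfae_have 5 → 4 := fun h s hs => h s (hGM.1 s hs)
    (OreData.IsGebauerMoeller.smallS_eq_zero D hGM hs)
  tfae_have 4 → 5 := fun h s ⟨_, hd⟩ hs =>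
    (D.hasLifting_iff hd).2 (D.liftsBelow_of_isGebauerMoeller hord hg hGM h hd hs)
  tfae_have 3 ↔ 4 := forall₂_congr fun s hs => by
    obtain ⟨d, hd⟩ := hGM.1 s hs
    rw [D.hasLifting_iff hd, D.hasQuasiGroebnerRep_iff_liftsBelow hd]
  tfae_finish
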